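/- Let $X_1,X_2,\dots$ be i.i.d. random variables with values in a measurable space $(E,\mathcal E)$ and with common law $\mu$, and write $[n]=\{1,\dots,n\}$, $\mathcal D_p(n)=\{J\subseteq[n]:|J|=p\}$ and $\mathcal F_L=\sigma(X_i,\,i\in L)$; vectors $(x_i)_{i\in J}$ are always listed in increasing order of the index. Notation. For a measurable symmetric kernel $\psi:E^p\to\mathbb R$ let $J_p^{(n)}(\psi)=\sum_{J\in\mathcal D_p(n)}\psi\bigl((X_j)_{j\in J}\bigr)$. A symmetric $\psi\in L^1(\mu^p)$, $p\ge1$, is *degenerate* if $\int_E\psi(x_1,x_2,\dots,x_p)\,d\mu(x_1)=0$ for $\mu^{p-1}$-a.a. $(x_2,\dots,x_p)$. For symmetric $\psi\in L^2(\mu^p)$, $\phi\in L^2(\mu^q)$ and $0\le l\le r\le p\wedge q$ the contraction $\psi\star_r^l\phi:E^{p+q-r-l}\to\mathbb R$ is $$(\psi\star_r^l\phi)(y,t,s)=\int_{E^l}\psi(x,y,t)\,\phi(x,y,s)\,d\mu^l(x),\qquad y\in E^{r-l},\ t\in E^{p-r},\ s\in E^{q-r},$$ set equal to $0$ where the integral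 does not exist. For $f\in L^1(\mu^k)$, the top component of the Hoeffding decomposition of $f$ is $$f_{[k]}(x_1,\dots,x_k)=\sum_{K\subseteq[k]}(-1)^{k-|K|}\int_{E^{k-|K|}}f(x_1,\dots,x_k)\,d\mu^{k-|K|}\bigl((x_i)_{i\in[k]\setminus K}\bigr).$$ For $n\le m$, $r\le p\wedge q$ and $L\subseteq[m]$ with $|L|\ge p+q-2r$, let $\Pi_{r,n,m}(L)$ be the set of all triples $(A,B,C)\in\mathcal D_{2r+|L|-p-q}(n)\times\mathcal D_{p-r}(n)\times\mathcal D_{q-r}(m)$ such that $L$ is the disjoint union of $A$, $B$ and $C$. The Hoeffding decomposition of an integrable function $T$ of $X_1,\dots,X_m$ is the decomposition $T=\sum_{M\subseteq[m]}U_M$ a.s. in which each $U_M$ is integrable and $\mathcal F_M$-measurable and $\mathbb E[U_M\mid\mathcal F_L]=0$ a.s. for all $L\subseteq[m]$ with $M\not\subseteq L$; its components are $U_M=\sum_{L\subseteq M}(-1)^{|M|-|L|}\,\mathbb E[T\mid\mathcal F_L]$ a.s. **Proposition (product formula).** Let $p,q\ge1$, let $\psi\in L^2(\mu^p)$ and $\phi\in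 L^2(\mu^q)$ be degenerate symmetric kernels of orders $p$ and $q$, and let $m\ge n\ge p+q$. Then $T=J_p^{(n)}(\psi)\,J_q^{(m)}(\phi)$ is integrable and its Hoeffding decomposition satisfies, almost surely, $$J_p^{(n)}(\psi)\,J_q^{(m)}(\phi)=\sum_{\substack{M\subseteq[m]\\|M|\le p+q}}U_M=\sum_{k=|p-q|}^{p+q}\ \sum_{s=0}^{q\wedge k\wedge(m-n)}\ \sum_{\substack{M\subseteq[m],\ |M|=k\\|M\cap\{n+1,\dots,m\}|=s}}U_M .$$ For every $M\subseteq[m]$ with $k:=|M|\le p+q$ and $s:=|M\cap\{n+1,\dots,m\}|\le q\wedge k\wedge(m-n)$ the component $U_M$ is given, almost surely, by $$U_M=\sum_{r=\lceil\frac{p+q-k}2\rceil}^{p\wedge(q-s)\wedge(p+q-k)}\binom{n-k+s}{p+q-r-k}\sum_{(A,B,C)\in\Pi_{r,n,m}(M)}\bigl(\psi\star_r^{p+q-r-k}\phi\bigr)_{[k]}\bigl((X_i)_{i\in A},(X_i)_{i\in B},(X_i)_{i\in C}\bigr),$$ and $$\sqrt{\operatorname{Var}(U_M)}\le\sum_{r=\lceil\frac{p+q-k}2\rceil}^{p\wedge(q-s)\wedge(p+q-k)}\binom{n-k+s}{p+q-r-k}\binom{k-s}{2r+k-p-q,\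 p-r,\ q-r-s}\bigl\|\psi\star_r^{p+q-r-k}\phi\bigr\|_{L^2(\mu^k)},$$ where both sides may be $+\infty$, $\binom{N}{a,b,c}=\frac{N!}{a!\,b!\,c!}$, and empty sums are $0$. -/

import Mathlib

open MeasureTheory ProbabilityTheory
open scoped ENNReal

namespace UStat

noncomputable section

/-- The product measure `μ^ι`, for a finite index type `ι`; `powMeasure μ (Fin p)` is `μ^p`. -/
abbrev powMeasure {E : Type*} [MeasurableSpace E] (μ : Measure E) (ι : Type*) [Fintype ι] :
    Measure (ι → E) :=
  Measure.pi fun _ : ι => μ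

/-- A kernel of order `p` is symmetric if it is invariant under permutations of its arguments. -/
def IsSymm {E : Type*} {p : ℕ} (ψ : (Fin p → E) → ℝ) : Prop :=
  ∀ (σ : Equiv.Perm (Fin p)) (x : Fin p → E), ψ (fun i => x (σ i)) = ψ x

/-- Complete degeneracy of a (symmetric, integrable) kernel of order `p ≥ 1`: the integral of `ψ`
with respect to its first argument vanishes for `μ^(p-1)`-almost all values of the others.
(No condition is imposed for `p = 0`, a case that is not used.) -/
def IsDegenerate {E : Type*} [MeasurableSpace E] (μ : Measure E) :
    {p : ℕ} → ((Fin p → E) → ℝ) → Prop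
  | 0, _ => True
  | p + 1, ψ => ∀ᵐ x : Fin p → E ∂powMeasure μ (Fin p), ∫ y, ψ (Fin.cons y x) ∂μ = 0

/-- `pick x J a` is the vector `(x_j)_{j ∈ J}` with the indices in increasing order, for a finite
set `J` with `a` elements (`Nat.nth (· ∈ J) i` is the `i`-th smallest element of `J`). -/
def pick {E : Type*} (x : ℕ → E) (J : Finset ℕ) (a : ℕ) : Fin a → E :=
  fun i => x (Nat.nth (fun j => j ∈ J) i)

/-- The `U`-statistic `J_p^{(n)}(ψ)`, based on the first `n` variables `X 0, …, X (n - 1)`. -/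
def uStat {Ω E : Type*} (X : ℕ → Ω → E) {p : ℕ} (n : ℕ) (ψ : (Fin p → E) → ℝ) (ω : Ω) : ℝ :=
  ∑ J ∈ Finset.powersetCard p (Finset.range n), ψ (pick (fun i => X i ω) J p)

/-- The vector `(x_1, …, x_l, y_1, …, y_{r-l}, t_1, …, t_{p-r})`, for `l ≤ r ≤ p`. -/
def join {E : Type*} {l r p : ℕ} (x : Fin l → E) (y : Fin (r - l) → E) (t : Fin (p - r) → E) :
    Fin p → E :=
  fun i =>
    if h₁ : i.val < l then x ⟨i.val, h₁⟩
    else if h₂ : i.val < r then y ⟨i.val - l, by omega⟩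
    else t ⟨i.val - r, by omega⟩

/-- The index set of the `p + q - r - l` arguments of the contraction `ψ ⋆_r^l φ`: the blocks
`y_1, …, y_{r-l}`, then `t_1, …, t_{p-r}`, then `s_1, …, s_{q-r}`. -/
abbrev Args (p q r l : ℕ) : Type :=
  Fin (r - l) ⊕ Fin (p - r) ⊕ Fin (q - r)

/-- The contraction kernel `ψ ⋆_r^l φ`, for `l ≤ r ≤ min p q`. The Bochner integral is `0` where
the integrand is not integrable, which is the usual convention for contractions. -/
def contraction {E : Type*} [MeasurableSpace E] (μ : Measure E) {p q : ℕ}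
    (ψ : (Fin p → E) → ℝ) (φ : (Fin q → E) → ℝ) (r l : ℕ) (z : Args p q r l → E) : ℝ :=
  ∫ x : Fin l → E,
    ψ (join x (fun i => z (Sum.inl i)) (fun i => z (Sum.inr (Sum.inl i)))) *
      φ (join x (fun i => z (Sum.inl i)) (fun i => z (Sum.inr (Sum.inr i))))
    ∂powMeasure μ (Fin l)

/-- The component `f_J` of the Hoeffding decomposition of a not necessarily symmetric kernel
`f : E^ι → ℝ`,
`f_J = ∑_{K ⊆ J} (-1)^{|J| - |K|} ∫ f(x) dμ^{ι \ K}((x_i)_{i ∉ K})`.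
It is written as a function of the whole vector `x`, and depends only on `(x_i)_{i ∈ J}`. -/
def kernelComponent {E ι : Type*} [MeasurableSpace E] [Fintype ι] [DecidableEq ι]
    (μ : Measure E) (f : (ι → E) → ℝ) (J : Finset ι) (x : ι → E) : ℝ :=
  ∑ K ∈ J.powerset, (-1 : ℝ) ^ (J.card - K.card) *
    ∫ y : {i : ι // i ∉ K} → E, f (fun i => if h : i ∈ K then x i else y ⟨i, h⟩)
      ∂powMeasure μ {i : ι // i ∉ K}

/-- `Π_{r,n,m}(L)`: the triples `(A, B, C)` with `A, B ⊆ [n]`, `C ⊆ [m]`,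
`|A| = 2r + |L| - p - q`, `|B| = p - r`, `|C| = q - r`, of which `L` is the disjoint union.
It is meant for `r ≤ min p q` and `|L| ≥ p + q - 2r`. Here `[n] = {0, …, n - 1}`. -/
def triples (p q r n m : ℕ) (L : Finset ℕ) : Finset (Finset ℕ × Finset ℕ × Finset ℕ) :=
  (Finset.powersetCard (2 * r + L.card - (p + q)) (Finset.range n) ×ˢ
    Finset.powersetCard (p - r) (Finset.range n) ×ˢ
      Finset.powersetCard (q - r) (Finset.range m)).filter
    fun T => Disjoint T.1 T.2.1 ∧ Disjoint T.1 T.2.2 ∧ Disjoint T.2.1 T.2.2 ∧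
      T.1 ∪ T.2.1 ∪ T.2.2 = L

/-- The vector `((x_i)_{i ∈ A}, (x_i)_{i ∈ B}, (x_i)_{i ∈ C})` as an argument of `ψ ⋆_r^l φ`. -/
def pickTriple {E : Type*} (x : ℕ → E) (p q r l : ℕ) (T : Finset ℕ × Finset ℕ × Finset ℕ) :
    Args p q r l → E :=
  Sum.elim (pick x T.1 (r - l)) (Sum.elim (pick x T.2.1 (p - r)) (pick x T.2.2 (q - r)))

/-- The range of summation `⌈(p + q - k) / 2⌉ ≤ r ≤ min p (q - s) (p + q - k)`,
for `s ≤ q` and `k ≤ p + q`. -/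
def rRange (p q k s : ℕ) : Finset ℕ :=
  Finset.Icc ((p + q - k + 1) / 2) (min p (min (q - s) (p + q - k)))

/-- The multinomial coefficient `N! / (a! b! c!)`, for `N = a + b + c`. -/
def trinomial (N a b c : ℕ) : ℕ :=
  N.factorial / (a.factorial * b.factorial * c.factorial)

/-- The `σ`-algebra `F_L` generated by the variables `X i`, `i ∈ L`. -/
abbrev sigmaOf {Ω E : Type*} [mE : MeasurableSpace E] (X : ℕ → Ω → E) (L : Finset ℕ) :
    MeasurableSpace Ω :=
  ⨆ i ∈ L, MeasurableSpace.comap (X i) mE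

/-- The Hoeffding component `∑_{L ⊆ M} (-1)^{|M| - |L|} E[T | F_L]` of an integrable random
variable `T` that is a function of finitely many of the independent variables `X i`. -/
def hoeffdingComponent {Ω E : Type*} [MeasurableSpace Ω] [MeasurableSpace E] (P : Measure Ω)
    (X : ℕ → Ω → E) (T : Ω → ℝ) (M : Finset ℕ) (ω : Ω) : ℝ :=
  ∑ L ∈ M.powerset, (-1 : ℝ) ^ (M.card - L.card) * (P[T | sigmaOf X L]) ω

/-- The family `U M`, `M ⊆ [m]`, is the Hoeffding decomposition of `T` with respect to the first
`m` variables: `U M` is an integrable function of `(X i)_{i ∈ M}`, `E[U M | F_L] = 0` almost surely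
unless `M ⊆ L`, and `T` is the sum of all the `U M`. -/
structure IsHoeffdingDecomposition {Ω E : Type*} [MeasurableSpace Ω] [MeasurableSpace E]
    (P : Measure Ω) (X : ℕ → Ω → E) (m : ℕ) (T : Ω → ℝ) (U : Finset ℕ → Ω → ℝ) : Prop where
  measurable : ∀ M ⊆ Finset.range m, Measurable[sigmaOf X M] (U M)
  integrable : ∀ M ⊆ Finset.range m, Integrable (U M) P
  condExp_eq_zero : ∀ M ⊆ Finset.range m, ∀ L ⊆ Finset.range m, ¬ M ⊆ L →
    P[U M | sigmaOf X L] =ᵐ[P] 0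
  sum_eq : T =ᵐ[P] fun ω => ∑ M ∈ (Finset.range m).powerset, U M ω

end

end UStat

open UStat

/-! Write E_L for conditional expectation given F_L. By independence, E_L integrates out the
variables with index outside L, so E_L E_N = E_{N ∩ L} (`condExp_condExp`). The Hoeffding calculus
follows from this: Möbius inversion over the subsets of [m] makes the U_M sum to T, and if a ∈ M \
L, the terms of U_M indexed by K and K ∪ {a} cancel under E_L. The components are orthogonal
projections, so they do not increase the L² norm (`eLpNorm_hoeffdingComponent_le`).

The product T expands into terms ψ(X_J) φ(X_K). Degeneracy kills E_L of such a term unless J △ K ⊆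
L, and the term depends only on the variables in J ∪ K. Hence it contributes to U_M only if J △ K ⊆
M ⊆ J ∪ K (`hoeffdingComponent_pairProd_eq_zero`).

For such a pair put A = M ∩ J ∩ K, B = J \ K, C = K \ J, D = (J ∩ K) \ M and r = |J ∩ K|, so that
|D| = p + q - r - k. Conditioning on F_M integrates out the shared variables in D, which yields the
contraction of ψ and φ at (A, B, C), and its top component is the contribution to U_M
(`hoeffdingComponent_pairProd`). This does not depend on D ⊆ [n] \ M, so after reindexing by (r, (A,
B, C), D) (`sum_pairsAt`) the choice of D becomes a binomial factor. The variance bound follows from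
the triangle inequality, the L² bound on components and a multinomial count of the triples. -/

namespace UStat

/-- The variables `X i` are independent with common law `μ`. -/
structure IsIID {Ω E : Type*} [MeasurableSpace Ω] [MeasurableSpace E] (P : Measure Ω)
    (μ : Measure E) (X : ℕ → Ω → E) : Prop where
  measurable : ∀ i, Measurable (X i)
  indep : iIndepFun X P
  law : ∀ i, P.map (X i) = μ

/-! ### Conditional expectation given F_L as partial integration. -/

/-- Conditional expectation of a function of two independent variables, given the first one. -/
theorem condExp_comp_of_indepFun {Ω α β : Type*} [MeasurableSpace Ω] [mα : MeasurableSpace α]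
    [MeasurableSpace β] {P : Measure Ω} [IsProbabilityMeasure P] {Y : Ω → α} {Z : Ω → β}
    (hY : Measurable Y) (hZ : Measurable Z) (hYZ : IndepFun Y Z P) {f : α × β → ℝ}
    (hf : Measurable f) (hInt : Integrable (fun ω => f (Y ω, Z ω)) P) :
    P[fun ω => f (Y ω, Z ω) | mα.comap Y] =ᵐ[P] fun ω => ∫ z, f (Y ω, z) ∂(P.map Z) := by
  have : IsProbabilityMeasure (P.map Y) := Measure.isProbabilityMeasure_map hY.aemeasurable
  have : IsProbabilityMeasure (P.map Z) := Measure.isProbabilityMeasure_map hZ.aemeasurable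
  have hlaw := hYZ.map_prod_eq_prod_map_map hY.aemeasurable hZ.aemeasurable
  have hfi : Integrable f ((P.map Y).prod (P.map Z)) := by
    rw [← hlaw]
    exact (integrable_map_measure hf.aestronglyMeasurable (hY.prodMk hZ).aemeasurable).2 hInt
  have hgm : StronglyMeasurable fun y => ∫ z, f (y, z) ∂(P.map Z) :=
    hf.stronglyMeasurable.integral_prod_right'
  have hgi : Integrable (fun y => ∫ z, f (y, z) ∂(P.map Z)) (P.map Y) := hfi.integral_prod_left
  have hgi' : Integrable (fun ω => ∫ z, f (Y ω, z) ∂(P.map Z)) P := hgi.comp_measurable hY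
  refine (ae_eq_condExp_of_forall_setIntegral_eq hY.comap_le hInt
    (fun s _ _ => hgi'.integrableOn) ?_ ?_).symm
  · rintro s ⟨S, hS, rfl⟩ -
    calc ∫ ω in Y ⁻¹' S, (∫ z, f (Y ω, z) ∂(P.map Z)) ∂P
        = ∫ y in S, (∫ z, f (y, z) ∂(P.map Z)) ∂(P.map Y) :=
          (setIntegral_map hS hgm.aestronglyMeasurable hY.aemeasurable).symm
      _ = ∫ v in S ×ˢ Set.univ, f v ∂((P.map Y).prod (P.map Z)) := by
          rw [setIntegral_prod _ hfi.integrableOn]; simp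
      _ = ∫ ω in Y ⁻¹' S, f (Y ω, Z ω) ∂P := by
          rw [← hlaw, setIntegral_map (hS.prod .univ) hf.aestronglyMeasurable
            (hY.prodMk hZ).aemeasurable]
          congr 2
          ext ω; simp
  · exact (hgm.comp_measurable (comap_measurable Y)).aestronglyMeasurable

section

variable {Ω E : Type*} [mE : MeasurableSpace E]

/-- F_L is presented as generated by a single random vector, the form needed both for Fubini and for
factoring measurable functions through that vector. -/
theorem sigmaOf_eq_comap (X : ℕ → Ω → E) (L : Finset ℕ) :
    sigmaOf X L = MeasurableSpace.comap (fun ω (i : L) => X i ω) inferInstance := by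
  simp only [sigmaOf, MeasurableSpace.pi, MeasurableSpace.comap_iSup, MeasurableSpace.comap_comp,
    Function.comp_def]
  rw [iSup_subtype]

theorem sigmaOf_mono (X : ℕ → Ω → E) {K L : Finset ℕ} (h : K ⊆ L) : sigmaOf X K ≤ sigmaOf X L :=
  biSup_mono fun _ hi => h hi

theorem measurable_sigmaOf (X : ℕ → Ω → E) {L : Finset ℕ} {i : ℕ} (hi : i ∈ L) :
    Measurable[sigmaOf X L] (X i) :=
  Measurable.of_comap_le (le_biSup (fun i => MeasurableSpace.comap (X i) mE) hi)

theorem measurable_comp_sigmaOf {ι : Type*} (X : ℕ → Ω → E) {L : Finset ℕ} {e : ι → ℕ}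
    (he : ∀ i, e i ∈ L) {f : (ι → E) → ℝ} (hf : Measurable f) :
    Measurable[sigmaOf X L] fun ω => f fun i => X (e i) ω :=
  hf.comp (@measurable_pi_lambda _ _ _ (sigmaOf X L) _ _ fun i => measurable_sigmaOf X (he i))

namespace IsIID

variable [MeasurableSpace Ω] {P : Measure Ω} {μ : Measure E} {X : ℕ → Ω → E}

theorem sigmaOf_le (hX : IsIID P μ X) (L : Finset ℕ) : sigmaOf X L ≤ ‹MeasurableSpace Ω› :=
  iSup₂_le fun i _ => (hX.measurable i).comap_le

theorem measurable_pi (hX : IsIID P μ X)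
    {ι : Type*} (e : ι → ℕ) : Measurable fun ω i => X (e i) ω :=
  measurable_pi_lambda _ fun i => hX.measurable (e i)

variable [IsProbabilityMeasure P]

theorem map_eq (hX : IsIID P μ X) {ι : Type*} [Fintype ι] {e : ι → ℕ} (he : e.Injective) :
    P.map (fun ω i => X (e i) ω) = powMeasure μ ι := by
  rw [(iIndepFun_iff_map_fun_eq_pi_map fun i => (hX.measurable (e i)).aemeasurable).1
    (hX.indep.precomp he)]
  simp [hX.law]

theorem measurePreserving (hX : IsIID P μ X)
    {ι : Type*} [Fintype ι] {e : ι → ℕ} (he : e.Injective) :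
    MeasurePreserving (fun ω i => X (e i) ω) P (powMeasure μ ι) :=
  ⟨hX.measurable_pi e, hX.map_eq he⟩

/-- Conditioning on `F_L` integrates out the variables with indices outside `L`. -/
theorem condExp_eq_integral (hX : IsIID P μ X)
    {ι κ : Type*} [Fintype κ] {L : Finset ℕ} {e : ι → ℕ} {d : κ → ℕ}
    (he : ∀ i, e i ∈ L) (hd : d.Injective) (hdL : ∀ j, d j ∉ L)
    {f : (ι → E) × (κ → E) → ℝ} (hf : Measurable f)
    (hInt : Integrable (fun ω => f (fun i => X (e i) ω, fun j => X (d j) ω)) P) :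
    P[fun ω => f (fun i => X (e i) ω, fun j => X (d j) ω) | sigmaOf X L] =ᵐ[P]
      fun ω => ∫ y, f (fun i => X (e i) ω, y) ∂powMeasure μ κ := by
  classical
  rw [sigmaOf_eq_comap, ← hX.map_eq hd]
  refine condExp_comp_of_indepFun (Y := fun ω (i : L) => X i ω) (Z := fun ω j => X (d j) ω)
    (f := fun v : (L → E) × (κ → E) => f (fun i => v.1 ⟨e i, he i⟩, v.2))
    (hX.measurable_pi _) (hX.measurable_pi d) ?_ ?_ hInt
  · have h := hX.indep.indepFun_finset L (Finset.univ.image d)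
      (Finset.disjoint_right.2 fun j hj => by
        obtain ⟨j, -, rfl⟩ := Finset.mem_image.1 hj
        exact hdL j) hX.measurable
    exact h.comp (φ := id) (ψ := fun v j => v ⟨d j, Finset.mem_image_of_mem d (Finset.mem_univ j)⟩)
      measurable_id (measurable_pi_lambda _ fun j => measurable_pi_apply _)
  · exact hf.comp ((measurable_pi_lambda _ fun i =>
      (measurable_pi_apply _).comp measurable_fst).prodMk measurable_snd)

/-- Conditioning on `F_L` a function of `(X (e i))` integrates out the arguments outside
`K = e⁻¹(L)`. -/
theorem condExp_eq_integral_compl (hX : IsIID P μ X)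
    {ι : Type*} [Fintype ι] [DecidableEq ι] {L : Finset ℕ}
    {K : Finset ι} {e : ι → ℕ} (he : e.Injective) (hK : ∀ i, i ∈ K ↔ e i ∈ L)
    {f : (ι → E) → ℝ} (hf : Measurable f) (hInt : Integrable (fun ω => f fun i => X (e i) ω) P) :
    P[fun ω => f fun i => X (e i) ω | sigmaOf X L] =ᵐ[P]
      fun ω => ∫ y : {i // i ∉ K} → E, f (fun i => if h : i ∈ K then X (e i) ω else y ⟨i, h⟩)
        ∂powMeasure μ {i // i ∉ K} := by
  have h := hX.condExp_eq_integral (L := L) (e := fun i : {i // i ∈ K} => e i)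
    (d := fun i : {i // i ∉ K} => e i)
    (f := fun v => f fun i => if h : i ∈ K then v.1 ⟨i, h⟩ else v.2 ⟨i, h⟩)
    (fun i => (hK i).1 i.2) (he.comp Subtype.val_injective) (fun i hi => i.2 ((hK i).2 hi))
    (hf.comp (measurable_pi_lambda _ fun i => by
      by_cases h : i ∈ K
      · simp only [h, dite_true]
        exact (measurable_pi_apply _).comp measurable_fst
      · simp only [h, dite_false]
        exact (measurable_pi_apply _).comp measurable_snd))
  simpa using h (by simpa using hInt)

/-- The conditional expectation given `F_L` of a function of the `X (e i)` depends only on the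
intersection of `L` with the range of `e`. -/
theorem condExp_congr_sigmaOf (hX : IsIID P μ X) {ι : Type*} [Fintype ι] {L L' : Finset ℕ}
    {e : ι → ℕ} (he : e.Injective) (hL : ∀ i, e i ∈ L ↔ e i ∈ L')
    {f : (ι → E) → ℝ} (hf : Measurable f) (hInt : Integrable (fun ω => f fun i => X (e i) ω) P) :
    P[fun ω => f fun i => X (e i) ω | sigmaOf X L] =ᵐ[P]
      P[fun ω => f fun i => X (e i) ω | sigmaOf X L'] := by
  classical
  refine (hX.condExp_eq_integral_compl (L := L) (K := {i | e i ∈ L}) he (by simp) hf hInt).trans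
    (hX.condExp_eq_integral_compl (L := L') (K := {i | e i ∈ L}) he ?_ hf hInt).symm
  simpa using hL

/-- Conditioning on `F_L` a variable that is `F_N`-measurable amounts to conditioning on
`F_{N ∩ L}`. -/
theorem condExp_inter_of_measurable (hX : IsIID P μ X) {N L : Finset ℕ} {V : Ω → ℝ}
    (hV : Measurable[sigmaOf X N] V) (hInt : Integrable V P) :
    P[V | sigmaOf X L] =ᵐ[P] P[V | sigmaOf X (N ∩ L)] := by
  -- Doob–Dynkin: V is a measurable function of (X_i), i ∈ N.
  rw [sigmaOf_eq_comap] at hV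
  obtain ⟨g, hg, rfl⟩ := hV.exists_eq_measurable_comp
  exact hX.condExp_congr_sigmaOf (e := fun i : N => (i : ℕ)) Subtype.val_injective
    (fun i => by simp) hg hInt

/-- E[V | F_N] depends only on the variables in N, so conditioning it on F_L is conditioning on F_{N
∩ L}; the tower property then applies. This is the only input from independence in the cancellation
arguments below. -/
theorem condExp_condExp (hX : IsIID P μ X) (N L : Finset ℕ) (V : Ω → ℝ) :
    P[P[V | sigmaOf X N] | sigmaOf X L] =ᵐ[P] P[V | sigmaOf X (N ∩ L)] :=
  (hX.condExp_inter_of_measurable stronglyMeasurable_condExp.measurable integrable_condExp).trans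
    (condExp_condExp_of_le (sigmaOf_mono X Finset.inter_subset_left) (hX.sigmaOf_le N))

end IsIID
end
end UStat

/-! ### Möbius inversion and orthogonality of Hoeffding components. -/

namespace UStat

/-- The alternating sum `∑_{L ⊆ M} (-1)^{|M| - |L|} c(L)`. -/
noncomputable def altSum {α : Type*} (c : Finset α → ℝ) (M : Finset α) : ℝ :=
  ∑ L ∈ M.powerset, (-1 : ℝ) ^ (M.card - L.card) * c L

theorem altSum_congr {α : Type*} {c d : Finset α → ℝ} {M : Finset α}
    (h : ∀ L ⊆ M, c L = d L) : altSum c M = altSum d M :=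
  Finset.sum_congr rfl fun L hL => by rw [h L (Finset.mem_powerset.1 hL)]

section

variable {α : Type*} [DecidableEq α]

/-- Subsets are split according to whether they contain a; those that do not acquire an extra sign.
The alternating sum is thus an iterated difference. -/
theorem altSum_insert (c : Finset α → ℝ) {a : α} {M : Finset α} (ha : a ∉ M) :
    altSum c (insert a M) = altSum (fun L => c (insert a L)) M - altSum c M := by
  rw [altSum, Finset.sum_powerset_insert ha, altSum, altSum, add_comm, sub_eq_add_neg,
    ← Finset.sum_neg_distrib]
  congr 1
  · refine Finset.sum_congr rfl fun L hL => ?_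
    have haL : a ∉ L := fun h => ha (Finset.mem_powerset.1 hL h)
    rw [Finset.card_insert_of_notMem ha, Finset.card_insert_of_notMem haL,
      Nat.add_sub_add_right]
  · refine Finset.sum_congr rfl fun L hL => ?_
    rw [Finset.card_insert_of_notMem ha,
      Nat.succ_sub (Finset.card_le_card (Finset.mem_powerset.1 hL)), pow_succ]
    ring

/-- Möbius inversion on the Boolean lattice: in the induction, the sets M and M ∪ {a} telescope. -/
theorem sum_altSum (c : Finset α → ℝ) (S : Finset α) :
    ∑ M ∈ S.powerset, altSum c M = c S := by
  induction S using Finset.induction_on generalizing c with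
  | empty => simp [altSum]
  | insert a S ha ih =>
    rw [Finset.sum_powerset_insert ha, ih, ← ih fun L => c (insert a L), ← ih c,
      ← Finset.sum_add_distrib]
    refine Finset.sum_congr rfl fun M hM => ?_
    rw [altSum_insert c fun h => ha (Finset.mem_powerset.1 hM h)]
    ring

/-- The terms of L and L ∪ {a} have opposite signs and cancel in pairs. -/
theorem altSum_eq_zero {c : Finset α → ℝ} {a : α} {M : Finset α} (ha : a ∈ M)
    (hc : ∀ L ⊆ M, c (insert a L) = c L) : altSum c M = 0 := by
  rw [← Finset.insert_erase ha, altSum_insert _ (Finset.notMem_erase a M), sub_eq_zero]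
  exact altSum_congr fun L hL => hc L (hL.trans (Finset.erase_subset a M))

end

variable {Ω E : Type*} [MeasurableSpace Ω] [mE : MeasurableSpace E] {P : Measure Ω}
  {μ : Measure E} {X : ℕ → Ω → E}

theorem hoeffdingComponent_eq_altSum (V : Ω → ℝ) (M : Finset ℕ) (ω : Ω) :
    hoeffdingComponent P X V M ω = altSum (fun L => (P[V | sigmaOf X L]) ω) M := rfl

theorem hoeffdingComponent_congr_of_condExp {V W : Ω → ℝ} {M : Finset ℕ}
    (h : ∀ L ⊆ M, P[V | sigmaOf X L] =ᵐ[P] P[W | sigmaOf X L]) :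
    hoeffdingComponent P X V M =ᵐ[P] hoeffdingComponent P X W M := by
  -- `Finset ℕ` is countable, so one null set serves for all L.
  have h' : ∀ᵐ ω ∂P, ∀ L, L ⊆ M → (P[V | sigmaOf X L]) ω = (P[W | sigmaOf X L]) ω :=
    ae_all_iff.2 fun L => by
      by_cases hL : L ⊆ M
      · filter_upwards [h L hL] with ω hω _ using hω
      · exact .of_forall fun ω h => absurd h hL
  filter_upwards [h'] with ω hω
  exact altSum_congr fun L hL => hω L hL

theorem hoeffdingComponent_congr {V W : Ω → ℝ} (h : V =ᵐ[P] W) (M : Finset ℕ) :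
    hoeffdingComponent P X V M =ᵐ[P] hoeffdingComponent P X W M :=
  hoeffdingComponent_congr_of_condExp fun _ _ => condExp_congr_ae h

theorem stronglyMeasurable_hoeffdingComponent (V : Ω → ℝ) (M : Finset ℕ) :
    StronglyMeasurable[sigmaOf X M] (hoeffdingComponent P X V M) :=
  Finset.stronglyMeasurable_fun_sum _ fun _ hL => StronglyMeasurable.const_mul
    (stronglyMeasurable_condExp.mono (sigmaOf_mono X (Finset.mem_powerset.1 hL))) _

theorem integrable_hoeffdingComponent (V : Ω → ℝ) (M : Finset ℕ) :
    Integrable (hoeffdingComponent P X V M) P :=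
  integrable_finsetSum _ fun _ _ => integrable_condExp.const_mul _

theorem memLp_hoeffdingComponent [IsFiniteMeasure P] {V : Ω → ℝ} (hV : MemLp V 2 P)
    (M : Finset ℕ) : MemLp (hoeffdingComponent P X V M) 2 P :=
  memLp_finsetSum _ fun _ _ => (hV.condExp one_le_two).const_mul _

theorem hoeffdingComponent_sum {ι : Type*} (s : Finset ι) {V : ι → Ω → ℝ}
    (hV : ∀ i ∈ s, Integrable (V i) P) (M : Finset ℕ) :
    hoeffdingComponent P X (fun ω => ∑ i ∈ s, V i ω) M =ᵐ[P]
      fun ω => ∑ i ∈ s, hoeffdingComponent P X (V i) M ω := by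
  have h : ∀ᵐ ω ∂P, ∀ L, (P[fun ω => ∑ i ∈ s, V i ω | sigmaOf X L]) ω
      = ∑ i ∈ s, (P[V i | sigmaOf X L]) ω := ae_all_iff.2 fun L => by
    have h := condExp_finsetSum (μ := P) hV (sigmaOf X L)
    filter_upwards [h] with ω hω
    rw [Finset.sum_apply] at hω
    rw [← hω]
    congr 2
    ext; simp
  filter_upwards [h] with ω hω
  simp only [hoeffdingComponent, hω, Finset.mul_sum]
  exact Finset.sum_comm

/-- The standard deviation is at most the `L²` norm. -/
theorem evariance_rpow_le_eLpNorm [IsProbabilityMeasure P] {V : Ω → ℝ}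
    (hV : AEStronglyMeasurable V P) : evariance V P ^ (1 / 2 : ℝ) ≤ eLpNorm V 2 P := by
  rw [eLpNorm_eq_lintegral_rpow_enorm_toReal two_ne_zero ENNReal.ofNat_ne_top, evariance_def' hV]
  simp only [ENNReal.toReal_ofNat, ENNReal.rpow_ofNat]
  exact ENNReal.rpow_le_rpow tsub_le_self (by norm_num)

namespace IsIID

variable [IsProbabilityMeasure P]

/-- For a ∈ M \ L, conditioning on F_L turns the K-th term into E[V | F_{K ∩ L}], which does not see
whether a ∈ K, so the terms cancel in pairs. -/
theorem condExp_hoeffdingComponent (hX : IsIID P μ X) (V : Ω → ℝ) {M L : Finset ℕ} (hML : ¬ M ⊆ L) :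
    P[hoeffdingComponent P X V M | sigmaOf X L] =ᵐ[P] 0 := by
  obtain ⟨a, haM, haL⟩ := Finset.not_subset.1 hML
  have h1 := condExp_finsetSum (μ := P) (s := M.powerset)
    (f := fun K ω => (-1 : ℝ) ^ (M.card - K.card) * (P[V | sigmaOf X K]) ω)
    (fun _ _ => integrable_condExp.const_mul _) (sigmaOf X L)
  have h2 : ∀ᵐ ω ∂P, ∀ K : Finset ℕ,
      (P[fun ω => (-1 : ℝ) ^ (M.card - K.card) * (P[V | sigmaOf X K]) ω | sigmaOf X L]) ω
        = (-1 : ℝ) ^ (M.card - K.card) * (P[V | sigmaOf X (K ∩ L)]) ω :=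
    ae_all_iff.2 fun K => by
      filter_upwards [condExp_smul ((-1 : ℝ) ^ (M.card - K.card)) (P[V | sigmaOf X K])
        (sigmaOf X L) (μ := P), hX.condExp_condExp K L V] with ω hω hω'
      rw [← hω', ← smul_eq_mul, ← Pi.smul_apply, ← hω]
      rfl
  have h3 : hoeffdingComponent P X V M
      = ∑ K ∈ M.powerset, fun ω => (-1 : ℝ) ^ (M.card - K.card) * (P[V | sigmaOf X K]) ω := by
    ext ω; simp [hoeffdingComponent]
  rw [h3]
  filter_upwards [h1, h2] with ω hω hω'
  rw [hω, Finset.sum_apply]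
  simp only [hω']
  refine altSum_eq_zero (c := fun K => (P[V | sigmaOf X (K ∩ L)]) ω) haM fun K _ => ?_
  rw [Finset.insert_inter_of_notMem haL]

/-- The same cancellation, with a ∈ M \ N: V does not depend on X_a. -/
theorem hoeffdingComponent_eq_zero (hX : IsIID P μ X) {V : Ω → ℝ} {N M : Finset ℕ}
    (hV : Measurable[sigmaOf X N] V) (hInt : Integrable V P) (hMN : ¬ M ⊆ N) :
    hoeffdingComponent P X V M =ᵐ[P] 0 := by
  obtain ⟨a, haM, haN⟩ := Finset.not_subset.1 hMN
  have h : ∀ᵐ ω ∂P, ∀ L, (P[V | sigmaOf X L]) ω = (P[V | sigmaOf X (N ∩ L)]) ω :=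
    ae_all_iff.2 fun L => hX.condExp_inter_of_measurable hV hInt
  filter_upwards [h] with ω hω
  refine altSum_eq_zero (c := fun K => (P[V | sigmaOf X K]) ω) haM fun K _ => ?_
  rw [hω, hω K, Finset.inter_insert_of_notMem haN]

theorem isHoeffdingDecomposition (hX : IsIID P μ X) {V : Ω → ℝ} {m : ℕ}
    (hV : Measurable[sigmaOf X (Finset.range m)] V) (hInt : Integrable V P) :
    IsHoeffdingDecomposition P X m V (hoeffdingComponent P X V) where
  measurable M _ := (stronglyMeasurable_hoeffdingComponent V M).measurable
  integrable M _ := integrable_hoeffdingComponent V M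
  condExp_eq_zero M _ L _ h := hX.condExp_hoeffdingComponent V h
  sum_eq := by
    refine .of_forall fun ω => ?_
    simp only [hoeffdingComponent_eq_altSum]
    rw [sum_altSum, condExp_of_stronglyMeasurable (hX.sigmaOf_le _) hV.stronglyMeasurable hInt]

theorem hoeffdingComponent_condExp (hX : IsIID P μ X) (V : Ω → ℝ) (M : Finset ℕ) :
    hoeffdingComponent P X (P[V | sigmaOf X M]) M =ᵐ[P] hoeffdingComponent P X V M :=
  hoeffdingComponent_congr_of_condExp fun _ hL =>
    condExp_condExp_of_le (sigmaOf_mono X hL) (hX.sigmaOf_le M)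

/-- The factor E[V | F_L] can be pulled out when the product is conditioned on F_L. -/
theorem integral_mul_condExp_eq_zero (hX : IsIID P μ X)
    {U V : Ω → ℝ} {L : Finset ℕ} (hU : MemLp U 2 P)
    (hV : MemLp V 2 P) (h : P[U | sigmaOf X L] =ᵐ[P] 0) :
    ∫ ω, (P[V | sigmaOf X L]) ω * U ω ∂P = 0 := by
  have hc := condExp_mul_of_stronglyMeasurable_left (μ := P)
    (stronglyMeasurable_condExp (μ := P) (f := V) (m := sigmaOf X L))
    ((hV.condExp one_le_two).integrable_mul hU) (hU.integrable one_le_two)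
  rw [← integral_condExp (hX.sigmaOf_le L)]
  refine integral_eq_zero_of_ae ?_
  filter_upwards [hc, h] with ω hω hω'
  change (P[P[V | sigmaOf X L] * U | sigmaOf X L]) ω = 0
  rw [hω, Pi.mul_apply, hω']
  simp

/-- One factor U_M is expanded. The terms with L ≠ M are orthogonal to U_M, and in the term L = M
the factor E[V | F_M] may be replaced by V. Equivalently, U_M is orthogonal to V - U_M. -/
theorem integral_sq_hoeffdingComponent (hX : IsIID P μ X)
    {V : Ω → ℝ} (hV : MemLp V 2 P) (M : Finset ℕ) :
    ∫ ω, hoeffdingComponent P X V M ω ^ 2 ∂P = ∫ ω, hoeffdingComponent P X V M ω * V ω ∂P := by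
  set U := hoeffdingComponent P X V M with hU
  have hU2 : MemLp U 2 P := memLp_hoeffdingComponent hV M
  have h1 : ∀ ω, U ω ^ 2 = ∑ L ∈ M.powerset,
      (-1 : ℝ) ^ (M.card - L.card) * ((P[V | sigmaOf X L]) ω * U ω) := fun ω => by
    rw [sq]
    nth_rewrite 1 [hU]
    simp only [hoeffdingComponent, Finset.sum_mul, mul_assoc]
  simp only [h1]
  have hi : ∀ L : Finset ℕ, Integrable (fun ω => (P[V | sigmaOf X L]) ω * U ω) P := fun L =>
    (hV.condExp one_le_two).integrable_mul hU2
  rw [integral_finsetSum _ fun L _ => (hi L).const_mul _]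
  simp only [integral_const_mul]
  rw [Finset.sum_eq_single M]
  · have hc := condExp_mul_of_stronglyMeasurable_left (μ := P)
      (stronglyMeasurable_hoeffdingComponent (P := P) (X := X) V M)
      (hU2.integrable_mul hV) (hV.integrable one_le_two)
    rw [← integral_condExp (hX.sigmaOf_le M) (f := fun ω => U ω * V ω)]
    simp only [Nat.sub_self, pow_zero, one_mul]
    refine integral_congr_ae ?_
    filter_upwards [hc] with ω hω
    rw [mul_comm]
    exact hω.symm
  · intro L hL hne
    rw [hX.integral_mul_condExp_eq_zero hU2 hV (hX.condExp_hoeffdingComponent V fun h =>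
      hne (subset_antisymm (Finset.mem_powerset.1 hL) h)), mul_zero]
  · simp

/-- The Hoeffding components are orthogonal projections, hence contractions of `L²`. -/
theorem eLpNorm_hoeffdingComponent_le (hX : IsIID P μ X) {V : Ω → ℝ} (hV : AEStronglyMeasurable V P)
    (M : Finset ℕ) : eLpNorm (hoeffdingComponent P X V M) 2 P ≤ eLpNorm V 2 P := by
  by_cases htop : eLpNorm V 2 P = ∞
  · simp [htop]
  have hV2 : MemLp V 2 P := ⟨hV, lt_top_iff_ne_top.2 htop⟩
  have hU2 : MemLp (hoeffdingComponent P X V M) 2 P := memLp_hoeffdingComponent hV2 M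
  have h := hX.integral_sq_hoeffdingComponent hV2 M
  -- By orthogonality this integral equals ‖V‖² - ‖U_M‖².
  have h0 : 0 ≤ ∫ ω, (V ω - hoeffdingComponent P X V M ω) ^ 2 ∂P :=
    integral_nonneg fun ω => sq_nonneg _
  have h1 : ∫ ω, (V ω - hoeffdingComponent P X V M ω) ^ 2 ∂P
      = ∫ ω, V ω ^ 2 ∂P - 2 * ∫ ω, hoeffdingComponent P X V M ω * V ω ∂P
        + ∫ ω, hoeffdingComponent P X V M ω ^ 2 ∂P := by
    have hi : Integrable (fun ω => 2 * (hoeffdingComponent P X V M ω * V ω)) P :=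
      (hU2.integrable_mul hV2).const_mul 2
    have hi' : Integrable (fun ω => V ω ^ 2 - 2 * (hoeffdingComponent P X V M ω * V ω)) P :=
      hV2.integrable_sq.sub hi
    rw [← integral_const_mul, ← integral_sub hV2.integrable_sq hi,
      ← integral_add hi' hU2.integrable_sq]
    exact integral_congr_ae (.of_forall fun ω => by ring)
  rw [hU2.eLpNorm_eq_integral_rpow_norm two_ne_zero ENNReal.ofNat_ne_top,
    hV2.eLpNorm_eq_integral_rpow_norm two_ne_zero ENNReal.ofNat_ne_top]
  refine ENNReal.ofReal_le_ofReal (Real.rpow_le_rpow ?_ ?_ (by positivity))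
  · exact integral_nonneg fun ω => by positivity
  · simp only [ENNReal.toReal_ofNat, Real.rpow_ofNat, Real.norm_eq_abs, sq_abs]
    linarith

end IsIID
end UStat

/-! ### Enumerations of index sets, kernels along the sequence, degeneracy. -/

namespace UStat

/-- The increasing enumeration of the elements of a finite set with `a` elements. -/
noncomputable def enum (J : Finset ℕ) (a : ℕ) : Fin a → ℕ := fun i => Nat.nth (fun j => j ∈ J) i

theorem pick_eq {E : Type*} (x : ℕ → E) (J : Finset ℕ) (a : ℕ) :
    pick x J a = fun i => x (enum J a i) := rfl

theorem enum_mem {J : Finset ℕ} {a : ℕ} (h : J.card = a) (i : Fin a) : enum J a i ∈ J := by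
  have hf : {j | j ∈ J}.Finite := J.finite_toSet
  exact Nat.nth_mem_of_lt_card (p := fun j => j ∈ J) hf (by simp [h])

theorem enum_injective {J : Finset ℕ} {a : ℕ} (h : J.card = a) : (enum J a).Injective := by
  have hf : {j | j ∈ J}.Finite := J.finite_toSet
  intro i j hij
  exact Fin.ext (Nat.nth_injOn (p := fun j => j ∈ J) hf (by simp [h]) (by simp [h]) hij)

theorem image_eq_of_injective {ι : Type*} [Fintype ι] {e : ι → ℕ} {J : Finset ℕ}
    (he : e.Injective) (hJ : ∀ i, e i ∈ J) (hcard : J.card = Fintype.card ι) :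
    Finset.univ.image e = J :=
  Finset.eq_of_subset_of_card_le (Finset.image_subset_iff.2 fun i _ => hJ i)
    (by rw [Finset.card_image_of_injective _ he, hcard, Finset.card_univ])

/-- A symmetric kernel evaluated along two enumerations of the same set. -/
theorem IsSymm.comp_eq {E : Type*} {p : ℕ} {ψ : (Fin p → E) → ℝ} (hψ : IsSymm ψ) {J : Finset ℕ}
    (hJ : J.card = p) {e d : Fin p → ℕ} (he : e.Injective) (heJ : ∀ i, e i ∈ J)
    (hd : d.Injective) (hdJ : ∀ i, d i ∈ J) (x : ℕ → E) :
    ψ (fun i => x (e i)) = ψ (fun i => x (d i)) := by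
  have key : ∀ {c : Fin p → ℕ}, c.Injective → (hc : ∀ i, c i ∈ J) →
      Function.Bijective fun i => (⟨c i, hc i⟩ : J) := fun hc hcJ =>
    (Fintype.bijective_iff_injective_and_card _).2
      ⟨fun i j h => hc (congrArg Subtype.val h), by simp [hJ]⟩
  -- The permutation d⁻¹ ∘ e of the positions.
  let σ := (Equiv.ofBijective _ (key he heJ)).trans (Equiv.ofBijective _ (key hd hdJ)).symm
  rw [← hψ σ fun i => x (d i)]
  congr 1
  ext i
  have h : (Equiv.ofBijective _ (key hd hdJ)) (σ i) = (Equiv.ofBijective _ (key he heJ)) i := by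
    simp [σ]
  have h' : d (σ i) = e i := congrArg Subtype.val h
  rw [h']

theorem join_comp {E : Type*} {l r p : ℕ} (x : ℕ → E) (a : Fin l → ℕ) (b : Fin (r - l) → ℕ)
    (c : Fin (p - r) → ℕ) :
    (join (fun i => x (a i)) (fun i => x (b i)) (fun i => x (c i)) : Fin p → E)
      = fun i => x ((join a b c : Fin p → ℕ) i) := by
  ext i
  simp only [join]
  split_ifs <;> rfl

theorem join_enum_mem {l r p : ℕ} {D A B : Finset ℕ} (hD : D.card = l)
    (hA : A.card = r - l) (hB : B.card = p - r) (i : Fin p) :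
    join (enum D l) (enum A (r - l)) (enum B (p - r)) i ∈ A ∪ B ∪ D := by
  simp only [join, Finset.mem_union]
  split_ifs
  · exact .inr (enum_mem hD _)
  · exact .inl (.inl (enum_mem hA _))
  · exact .inl (.inr (enum_mem hB _))

theorem join_enum_injective {l r p : ℕ} {D A B : Finset ℕ} (hD : D.card = l)
    (hA : A.card = r - l) (hB : B.card = p - r) (hDA : Disjoint D A) (hDB : Disjoint D B)
    (hAB : Disjoint A B) :
    (join (enum D l) (enum A (r - l)) (enum B (p - r)) : Fin p → ℕ).Injective := by
  intro i j hij
  simp only [join] at hij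
  split_ifs at hij with h₁ h₂ h₃ h₄ h₅ h₆
  · exact Fin.ext (by simpa using enum_injective hD hij)
  · exact absurd hij (Finset.disjoint_iff_ne.1 hDA _ (enum_mem hD _) _ (enum_mem hA _))
  · exact absurd hij (Finset.disjoint_iff_ne.1 hDB _ (enum_mem hD _) _ (enum_mem hB _))
  · exact absurd hij.symm (Finset.disjoint_iff_ne.1 hDA _ (enum_mem hD _) _ (enum_mem hA _))
  · have h := enum_injective hA hij
    simp only [Fin.mk.injEq] at h
    exact Fin.ext (by omega)
  · exact absurd hij (Finset.disjoint_iff_ne.1 hAB _ (enum_mem hA _) _ (enum_mem hB _))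
  · exact absurd hij.symm (Finset.disjoint_iff_ne.1 hDB _ (enum_mem hD _) _ (enum_mem hB _))
  · exact absurd hij.symm (Finset.disjoint_iff_ne.1 hAB _ (enum_mem hA _) _ (enum_mem hB _))
  · have h := enum_injective hB hij
    simp only [Fin.mk.injEq] at h
    exact Fin.ext (by omega)

theorem measurable_join {E α : Type*} [MeasurableSpace E] [MeasurableSpace α] {l r p : ℕ}
    {x : α → Fin l → E} {y : α → Fin (r - l) → E} {t : α → Fin (p - r) → E} (hx : Measurable x)
    (hy : Measurable y) (ht : Measurable t) :
    Measurable fun a => (join (x a) (y a) (t a) : Fin p → E) := by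
  refine measurable_pi_lambda _ fun i => ?_
  simp only [join]
  split_ifs
  · exact (measurable_pi_apply _).comp hx
  · exact (measurable_pi_apply _).comp hy
  · exact (measurable_pi_apply _).comp ht

/-- The integrand of the contraction `ψ ⋆_r^l φ`. -/
def contractionIntegrand {E : Type*} {p q : ℕ} (ψ : (Fin p → E) → ℝ) (φ : (Fin q → E) → ℝ)
    (r l : ℕ) (v : (Args p q r l → E) × (Fin l → E)) : ℝ :=
  ψ (join v.2 (fun i => v.1 (Sum.inl i)) (fun i => v.1 (Sum.inr (Sum.inl i)))) *
    φ (join v.2 (fun i => v.1 (Sum.inl i)) (fun i => v.1 (Sum.inr (Sum.inr i))))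

section

variable {E : Type*} [MeasurableSpace E] {p q : ℕ} {ψ : (Fin p → E) → ℝ} {φ : (Fin q → E) → ℝ}

theorem measurable_contractionIntegrand (hψ : Measurable ψ) (hφ : Measurable φ) (r l : ℕ) :
    Measurable (contractionIntegrand ψ φ r l) := by
  have h : ∀ {κ : Type} (c : κ → Args p q r l),
      Measurable fun v : (Args p q r l → E) × (Fin l → E) => fun i => v.1 (c i) := fun c =>
    measurable_pi_lambda _ fun i => (measurable_pi_apply _).comp measurable_fst
  exact (hψ.comp (measurable_join measurable_snd (h _) (h _))).mul
    (hφ.comp (measurable_join measurable_snd (h _) (h _)))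

theorem measurable_contraction (μ : Measure E) [IsProbabilityMeasure μ] (hψ : Measurable ψ)
    (hφ : Measurable φ) (r l : ℕ) : Measurable (contraction μ ψ φ r l) :=
  (measurable_contractionIntegrand hψ hφ r l).stronglyMeasurable.integral_prod_right'.measurable

theorem measurable_kernelComponent {ι : Type*} [Fintype ι] [DecidableEq ι] (μ : Measure E)
    [IsProbabilityMeasure μ] {f : (ι → E) → ℝ} (hf : Measurable f) (J : Finset ι) :
    Measurable (kernelComponent μ f J) := by
  refine Finset.measurable_fun_sum _ fun K _ => Measurable.const_mul ?_ _
  have hm : Measurable fun v : (ι → E) × ({i // i ∉ K} → E) =>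
      f fun i => if h : i ∈ K then v.1 i else v.2 ⟨i, h⟩ := by
    refine hf.comp (measurable_pi_lambda _ fun i => ?_)
    by_cases h : i ∈ K
    · simp only [h, dite_true]
      exact (measurable_pi_apply _).comp measurable_fst
    · simp only [h, dite_false]
      exact (measurable_pi_apply _).comp measurable_snd
  exact hm.stronglyMeasurable.integral_prod_right'.measurable

end

variable {Ω E : Type*} [MeasurableSpace Ω] [mE : MeasurableSpace E] {P : Measure Ω}
  {μ : Measure E} {X : ℕ → Ω → E}

namespace IsIID

variable [IsProbabilityMeasure P]

/-- The injection e matches sets of argument positions with subsets of M and preserves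
cardinalities, so the two alternating sums agree term by term. -/
theorem kernelComponent_ae_eq (hX : IsIID P μ X) {ι : Type*} [Fintype ι] [DecidableEq ι] {e : ι → ℕ}
    (he : e.Injective) {f : (ι → E) → ℝ} (hf : Measurable f)
    (hInt : Integrable (fun ω => f fun i => X (e i) ω) P) {M : Finset ℕ}
    (hM : Finset.univ.image e = M) :
    hoeffdingComponent P X (fun ω => f fun i => X (e i) ω) M =ᵐ[P]
      fun ω => kernelComponent μ f Finset.univ fun i => X (e i) ω := by
  have h : ∀ᵐ ω ∂P, ∀ K : Finset ι,
      (P[fun ω => f fun i => X (e i) ω | sigmaOf X (K.image e)]) ω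
        = ∫ y : {i // i ∉ K} → E, f (fun i => if h : i ∈ K then X (e i) ω else y ⟨i, h⟩)
          ∂powMeasure μ {i // i ∉ K} :=
    ae_all_iff.2 fun K => hX.condExp_eq_integral_compl he
      (fun i => he.mem_finset_image.symm) hf hInt
  filter_upwards [h] with ω hω
  rw [hoeffdingComponent, kernelComponent, ← hM]
  symm
  refine Finset.sum_bij (fun K _ => K.image e) ?_ ?_ ?_ ?_
  · exact fun K _ => Finset.mem_powerset.2 (Finset.image_subset_image (Finset.subset_univ K))
  · exact fun K _ K' _ h => Finset.image_injective he h
  · intro L hL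
    obtain ⟨K, hK, rfl⟩ := Finset.subset_image_iff.1 (Finset.mem_powerset.1 hL)
    exact ⟨K, by simp, rfl⟩
  · intro K _
    rw [hω, Finset.card_image_of_injective _ he, Finset.card_image_of_injective _ he]

/-- The L² bound on components, transported to kernels. An infinite norm is allowed because a
contraction of L² kernels need not be square integrable. -/
theorem eLpNorm_kernelComponent_le (hX : IsIID P μ X)
    {ι : Type*} [Fintype ι] [DecidableEq ι] {e : ι → ℕ}
    (he : e.Injective) {f : (ι → E) → ℝ} (hf : Measurable f) :
    eLpNorm (fun ω => kernelComponent μ f Finset.univ fun i => X (e i) ω) 2 P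
      ≤ eLpNorm f 2 (powMeasure μ ι) := by
  by_cases htop : eLpNorm f 2 (powMeasure μ ι) = ∞
  · simp [htop]
  have hmp := hX.measurePreserving he
  have hnorm : eLpNorm (fun ω => f fun i => X (e i) ω) 2 P = eLpNorm f 2 (powMeasure μ ι) :=
    eLpNorm_comp_measurePreserving hf.aestronglyMeasurable hmp
  have hm : AEStronglyMeasurable (fun ω => f fun i => X (e i) ω) P :=
    (hf.comp (hX.measurable_pi e)).aestronglyMeasurable
  have hInt : Integrable (fun ω => f fun i => X (e i) ω) P :=
    MemLp.integrable one_le_two ⟨hm, by rw [hnorm]; exact lt_top_iff_ne_top.2 htop⟩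
  rw [← eLpNorm_congr_ae (hX.kernelComponent_ae_eq he hf hInt rfl), ← hnorm]
  exact hX.eLpNorm_hoeffdingComponent_le hm _

theorem memLp_pick (hX : IsIID P μ X)
    {p : ℕ} {ψ : (Fin p → E) → ℝ} (hψ : MemLp ψ 2 (powMeasure μ (Fin p)))
    {J : Finset ℕ} (hJ : J.card = p) : MemLp (fun ω => ψ (pick (fun i => X i ω) J p)) 2 P :=
  hψ.comp_measurePreserving (hX.measurePreserving (enum_injective hJ))

/-- A degenerate kernel evaluated at `(X_j)_{j ∈ J}` has conditional expectation zero given `F_L`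
unless `J ⊆ L`. -/
theorem condExp_pick_eq_zero (hX : IsIID P μ X)
    {p : ℕ} (hp : 1 ≤ p) {ψ : (Fin p → E) → ℝ} (hψm : Measurable ψ)
    (hψ2 : MemLp ψ 2 (powMeasure μ (Fin p))) (hψs : IsSymm ψ) (hψd : IsDegenerate μ ψ)
    {J : Finset ℕ} (hJ : J.card = p) {L : Finset ℕ} (hL : ¬ J ⊆ L) :
    P[fun ω => ψ (pick (fun i => X i ω) J p) | sigmaOf X L] =ᵐ[P] 0 := by
  obtain ⟨p, rfl⟩ : ∃ p', p = p' + 1 := ⟨p - 1, by omega⟩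
  have : IsProbabilityMeasure μ := by
    rw [← hX.law 0]; exact Measure.isProbabilityMeasure_map (hX.measurable 0).aemeasurable
  obtain ⟨j, hjJ, hjL⟩ := Finset.not_subset.1 hL
  -- By symmetry the missing index j may be listed first, in the argument for which degeneracy is
  -- stated.
  have hcard : (J.erase j).card = p := by rw [Finset.card_erase_of_mem hjJ, hJ]; simp
  have hinj := enum_injective hcard
  set e := enum (J.erase j) p
  have heJ : ∀ i, e i ∈ J.erase j := enum_mem hcard
  have hcons : ∀ ω, ψ (pick (fun i => X i ω) J (p + 1))
      = ψ (Fin.cons (X j ω) fun i => X (e i) ω) := fun ω => by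
    have h := hψs.comp_eq hJ (enum_injective hJ) (enum_mem hJ) (d := Fin.cons j e)
      (Fin.cons_injective_iff.2 ⟨?_, hinj⟩) ?_ fun i => X i ω
    · rw [pick_eq, h]
      congr 1
      ext i
      refine Fin.cases ?_ (fun i => ?_) i <;> simp
    · rintro ⟨i, hi⟩
      exact Finset.notMem_erase j J (hi ▸ heJ i)
    · refine Fin.cases hjJ fun i => ?_
      exact Finset.mem_of_mem_erase (heJ i)
  have hInt := (hX.memLp_pick hψ2 hJ).integrable one_le_two
  simp only [hcons] at hInt ⊢
  -- Conditioning on the larger F_{L ∪ (J \ {j})} fixes every argument except X_j, so degeneracy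
  -- gives zero; the tower property then descends to F_L.
  have h1 := hX.condExp_eq_integral (L := L ∪ J.erase j) (e := e) (d := fun _ : Unit => j)
    (f := fun v => ψ (Fin.cons (v.2 ()) v.1))
    (fun i => Finset.mem_union_right _ (heJ i)) (Function.injective_of_subsingleton _)
    (fun _ h => (Finset.mem_union.1 h).elim hjL (Finset.notMem_erase j J))
    (hψm.comp (measurable_pi_lambda _ fun i => by
      refine Fin.cases ?_ (fun i => ?_) i
      · simp only [Fin.cons_zero]
        exact (measurable_pi_apply _).comp measurable_snd
      · simp only [Fin.cons_succ]
        exact (measurable_pi_apply _).comp measurable_fst)) hInt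
  have h2 : ∀ x : Fin p → E, ∫ y : Unit → E, ψ (Fin.cons (y ()) x) ∂powMeasure μ Unit
      = ∫ y, ψ (Fin.cons y x) ∂μ := fun x =>
    (measurePreserving_funUnique μ Unit).integral_comp
      (MeasurableEquiv.funUnique Unit E).measurableEmbedding fun y => ψ (Fin.cons y x)
  have h3 : ∀ᵐ ω ∂P, ∫ y, ψ (Fin.cons y fun i => X (e i) ω) ∂μ = 0 :=
    (hX.measurePreserving hinj).quasiMeasurePreserving.ae hψd
  have h4 : P[fun ω => ψ (Fin.cons (X j ω) fun i => X (e i) ω) | sigmaOf X (L ∪ J.erase j)]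
      =ᵐ[P] 0 := by
    filter_upwards [h1, h3] with ω hω hω'
    rw [hω, h2, hω', Pi.zero_apply]
  refine (condExp_condExp_of_le (sigmaOf_mono X Finset.subset_union_left)
    (hX.sigmaOf_le (L ∪ J.erase j))).symm.trans ((condExp_congr_ae h4).trans ?_)
  rw [condExp_zero]

/-- Given F_{N ∪ L} the factor V pulls out, and Z is killed because J is not contained in N ∪ L; the
tower property descends to F_L. -/
theorem condExp_mul_eq_zero (hX : IsIID P μ X)
    {Z V : Ω → ℝ} {J N L : Finset ℕ} (hZ : Integrable Z P)
    (hV : Measurable[sigmaOf X N] V) (hVZ : Integrable (V * Z) P)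
    (h0 : ∀ L, ¬ J ⊆ L → P[Z | sigmaOf X L] =ᵐ[P] 0) (hL : ¬ J \ N ⊆ L) :
    P[V * Z | sigmaOf X L] =ᵐ[P] 0 := by
  have h1 : ¬ J ⊆ N ∪ L := fun h => hL (sdiff_le_iff.2 h)
  have h2 := condExp_mul_of_stronglyMeasurable_left (μ := P) (m := sigmaOf X (N ∪ L))
    (hV.mono (sigmaOf_mono X Finset.subset_union_left) le_rfl).stronglyMeasurable hVZ hZ
  have h3 : P[V * Z | sigmaOf X (N ∪ L)] =ᵐ[P] 0 := by
    filter_upwards [h2, h0 _ h1] with ω hω hω'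
    rw [hω, Pi.mul_apply, hω', Pi.zero_apply, mul_zero]
  refine (condExp_condExp_of_le (sigmaOf_mono X Finset.subset_union_right)
    (hX.sigmaOf_le (N ∪ L))).symm.trans ((condExp_congr_ae h3).trans ?_)
  rw [condExp_zero]

end IsIID
end UStat

/-! ### Hoeffding components of a single product ψ(X_J) φ(X_K). -/

namespace UStat

/-- The product `ψ((x_j)_{j ∈ J}) φ((x_j)_{j ∈ K})`. -/
noncomputable def pairProd {Ω E : Type*} (X : ℕ → Ω → E) {p q : ℕ} (ψ : (Fin p → E) → ℝ)
    (φ : (Fin q → E) → ℝ) (J K : Finset ℕ) (ω : Ω) : ℝ :=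
  ψ (pick (fun i => X i ω) J p) * φ (pick (fun i => X i ω) K q)

theorem uStat_mul_uStat {Ω E : Type*} (X : ℕ → Ω → E) {p q : ℕ} (ψ : (Fin p → E) → ℝ)
    (φ : (Fin q → E) → ℝ) (n m : ℕ) (ω : Ω) :
    uStat X n ψ ω * uStat X m φ ω = ∑ x ∈ Finset.powersetCard p (Finset.range n) ×ˢ
      Finset.powersetCard q (Finset.range m), pairProd X ψ φ x.1 x.2 ω := by
  rw [uStat, uStat, Finset.sum_mul_sum, ← Finset.sum_product']
  rfl

/-- The enumeration of `A ∪ B ∪ C` underlying `pickTriple`. -/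
noncomputable def enumTriple (p q r l : ℕ) (S : Finset ℕ × Finset ℕ × Finset ℕ) :
    Args p q r l → ℕ :=
  Sum.elim (enum S.1 (r - l)) (Sum.elim (enum S.2.1 (p - r)) (enum S.2.2 (q - r)))

theorem pickTriple_eq {E : Type*} (x : ℕ → E) (p q r l : ℕ)
    (S : Finset ℕ × Finset ℕ × Finset ℕ) :
    pickTriple x p q r l S = fun i => x (enumTriple p q r l S i) := by
  ext i
  rcases i with i | i | i <;> rfl

section

variable {p q r l : ℕ} {A B C : Finset ℕ}

theorem enumTriple_mem (hA : A.card = r - l) (hB : B.card = p - r)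
    (hC : C.card = q - r)
    (i : Args p q r l) : enumTriple p q r l (A, B, C) i ∈ A ∪ B ∪ C := by
  simp only [Finset.mem_union]
  rcases i with i | i | i
  · exact .inl (.inl (enum_mem hA i))
  · exact .inl (.inr (enum_mem hB i))
  · exact .inr (enum_mem hC i)

theorem enumTriple_injective (hA : A.card = r - l) (hB : B.card = p - r)
    (hC : C.card = q - r)
    (hAB : Disjoint A B) (hAC : Disjoint A C) (hBC : Disjoint B C) :
    (enumTriple p q r l (A, B, C)).Injective := by
  refine (enum_injective hA).sumElim
    ((enum_injective hB).sumElim (enum_injective hC) fun i j =>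
      Finset.disjoint_iff_ne.1 hBC _ (enum_mem hB i) _ (enum_mem hC j)) ?_
  rintro i (j | j)
  · exact Finset.disjoint_iff_ne.1 hAB _ (enum_mem hA i) _ (enum_mem hB j)
  · exact Finset.disjoint_iff_ne.1 hAC _ (enum_mem hA i) _ (enum_mem hC j)

theorem image_enumTriple (hA : A.card = r - l) (hB : B.card = p - r)
    (hC : C.card = q - r)
    (hAB : Disjoint A B) (hAC : Disjoint A C) (hBC : Disjoint B C) :
    Finset.univ.image (enumTriple p q r l (A, B, C)) = A ∪ B ∪ C := by
  refine image_eq_of_injective (enumTriple_injective hA hB hC hAB hAC hBC)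
    (enumTriple_mem hA hB hC) ?_
  rw [Finset.card_union_of_disjoint (Finset.disjoint_union_left.2 ⟨hAC, hBC⟩),
    Finset.card_union_of_disjoint hAB]
  simp only [hA, hB, hC, Fintype.card_sum, Fintype.card_fin]
  ring

end

theorem measurable_pairProd {Ω E : Type*} [MeasurableSpace E] {X : ℕ → Ω → E} {p q : ℕ}
    {ψ : (Fin p → E) → ℝ} {φ : (Fin q → E) → ℝ} {J K : Finset ℕ}
    (hψ : Measurable ψ) (hφ : Measurable φ) (hJ : J.card = p)
    (hK : K.card = q) {N : Finset ℕ} (hJN : J ⊆ N) (hKN : K ⊆ N) :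
    Measurable[sigmaOf X N] (pairProd X ψ φ J K) :=
  (measurable_comp_sigmaOf X (fun i => hJN (enum_mem hJ i)) hψ).mul
    (measurable_comp_sigmaOf X (fun i => hKN (enum_mem hK i)) hφ)

namespace IsIID

variable {Ω E : Type*} [MeasurableSpace Ω] [mE : MeasurableSpace E] {P : Measure Ω}
  {μ : Measure E} {X : ℕ → Ω → E} [IsProbabilityMeasure P]
  {p q : ℕ} {ψ : (Fin p → E) → ℝ} {φ : (Fin q → E) → ℝ} {J K : Finset ℕ}

theorem integrable_pairProd (hX : IsIID P μ X) (hψ : MemLp ψ 2 (powMeasure μ (Fin p)))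
    (hφ : MemLp φ 2 (powMeasure μ (Fin q))) (hJ : J.card = p) (hK : K.card = q) :
    Integrable (pairProd X ψ φ J K) P :=
  (hX.memLp_pick hψ hJ).integrable_mul (hX.memLp_pick hφ hK)

/-- The Hoeffding components of `ψ((X_j)_{j ∈ J}) φ((X_j)_{j ∈ K})` vanish outside the sets between
the symmetric difference and the union of `J` and `K`. -/
theorem hoeffdingComponent_pairProd_eq_zero (hX : IsIID P μ X)
    (hp : 1 ≤ p) (hq : 1 ≤ q) (hψm : Measurable ψ)
    (hψ2 : MemLp ψ 2 (powMeasure μ (Fin p))) (hψs : IsSymm ψ) (hψd : IsDegenerate μ ψ)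
    (hφm : Measurable φ) (hφ2 : MemLp φ 2 (powMeasure μ (Fin q))) (hφs : IsSymm φ)
    (hφd : IsDegenerate μ φ)
    (hJ : J.card = p) (hK : K.card = q) {M : Finset ℕ}
    (hM : ¬ (J \ K ⊆ M ∧ K \ J ⊆ M ∧ M ⊆ J ∪ K)) :
    hoeffdingComponent P X (pairProd X ψ φ J K) M =ᵐ[P] 0 := by
  have hInt := hX.integrable_pairProd hψ2 hφ2 hJ hK
  by_cases hM' : M ⊆ J ∪ K
  -- The component at M involves only F_L with L ⊆ M. If K \ J is not in L, the factor φ is averaged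
  -- out; if J \ K is not in L, the factor ψ is.
  · have h0 : ∀ L ⊆ M, P[pairProd X ψ φ J K | sigmaOf X L] =ᵐ[P] 0 := fun L hL => by
      by_cases h1 : J \ K ⊆ M
      · have h2 : ¬ K \ J ⊆ L := fun h => hM ⟨h1, h.trans hL, hM'⟩
        exact hX.condExp_mul_eq_zero ((hX.memLp_pick hφ2 hK).integrable one_le_two)
          (measurable_comp_sigmaOf X (fun i => enum_mem hJ i) hψm) hInt
          (fun L hL => hX.condExp_pick_eq_zero hq hφm hφ2 hφs hφd hK hL) h2
      · have h2 : ¬ J \ K ⊆ L := fun h => h1 (h.trans hL)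
        have hcomm : pairProd X ψ φ J K
            = (fun ω => φ (pick (fun i => X i ω) K q)) * fun ω => ψ (pick (fun i => X i ω) J p) :=
          funext fun ω => mul_comm _ _
        rw [hcomm] at hInt ⊢
        exact hX.condExp_mul_eq_zero ((hX.memLp_pick hψ2 hJ).integrable one_le_two)
          (measurable_comp_sigmaOf X (fun i => enum_mem hK i) hφm) hInt
          (fun L hL => hX.condExp_pick_eq_zero hp hψm hψ2 hψs hψd hJ hL) h2
    refine (hoeffdingComponent_congr_of_condExp (W := 0) fun L hL => ?_).trans ?_
    · rw [condExp_zero]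
      exact h0 L hL
    · exact .of_forall fun ω => by simp [hoeffdingComponent, condExp_zero]
  · exact hX.hoeffdingComponent_eq_zero
      (measurable_pairProd hψm hφm hJ hK Finset.subset_union_left Finset.subset_union_right)
      hInt hM'

/-- The Hoeffding component of `ψ((X_j)_{j ∈ J}) φ((X_j)_{j ∈ K})` at `M = A ∪ B ∪ C`, where
`J = A ∪ B ∪ D` and `K = A ∪ C ∪ D` are disjoint unions. -/
theorem hoeffdingComponent_pairProd (hX : IsIID P μ X)
    (hψm : Measurable ψ)
    (hψ2 : MemLp ψ 2 (powMeasure μ (Fin p))) (hψs : IsSymm ψ) (hφm : Measurable φ)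
    (hφ2 : MemLp φ 2 (powMeasure μ (Fin q))) (hφs : IsSymm φ)
    {r l : ℕ} {A B C D : Finset ℕ} (hlr : l ≤ r) (hrp : r ≤ p)
    (hrq : r ≤ q) (hA : A.card = r - l) (hB : B.card = p - r) (hC : C.card = q - r)
    (hD : D.card = l) (hAB : Disjoint A B) (hAC : Disjoint A C) (hBC : Disjoint B C)
    (hDA : Disjoint D A) (hDB : Disjoint D B) (hDC : Disjoint D C) :
    hoeffdingComponent P X (pairProd X ψ φ (A ∪ B ∪ D) (A ∪ C ∪ D)) (A ∪ B ∪ C) =ᵐ[P]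
      fun ω => kernelComponent μ (contraction μ ψ φ r l) Finset.univ
        (pickTriple (fun i => X i ω) p q r l (A, B, C)) := by
  have : IsProbabilityMeasure μ := by
    rw [← hX.law 0]; exact Measure.isProbabilityMeasure_map (hX.measurable 0).aemeasurable
  have hcard : ∀ {t : ℕ} {Z : Finset ℕ}, r ≤ t → Z.card = t - r → Disjoint A Z → Disjoint D Z →
      (A ∪ Z ∪ D).card = t := fun hrt hZ hAZ hDZ => by
    rw [Finset.card_union_of_disjoint (Finset.disjoint_union_left.2 ⟨hDA.symm, hDZ.symm⟩),
      Finset.card_union_of_disjoint hAZ, hA, hZ, hD]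
    omega
  have hJ := hcard hrp hB hAB hDB
  have hK := hcard hrq hC hAC hDC
  have hInt := hX.integrable_pairProd hψ2 hφ2 hJ hK
  set e := enumTriple p q r l (A, B, C)
  have heq : pairProd X ψ φ (A ∪ B ∪ D) (A ∪ C ∪ D) = fun ω =>
      contractionIntegrand ψ φ r l (fun i => X (e i) ω, fun j => X (enum D l j) ω) := by
    ext ω
    exact congrArg₂ (· * ·)
      ((hψs.comp_eq hJ (enum_injective hJ) (enum_mem hJ)
        (join_enum_injective hD hA hB hDA hDB hAB) (join_enum_mem hD hA hB) fun i => X i ω).trans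
          (congrArg ψ (join_comp (fun i => X i ω) (enum D l) (enum A (r - l)) (enum B (p - r))).symm))
      ((hφs.comp_eq hK (enum_injective hK) (enum_mem hK)
        (join_enum_injective hD hA hC hDA hDC hAC) (join_enum_mem hD hA hC) fun i => X i ω).trans
          (congrArg φ (join_comp (fun i => X i ω) (enum D l) (enum A (r - l)) (enum C (q - r))).symm))
  have hDM : ∀ j, enum D l j ∉ A ∪ B ∪ C := fun j hj => by
    have h := enum_mem hD j
    simp only [Finset.mem_union] at hj
    rcases hj with (hj | hj) | hj
    · exact Finset.disjoint_left.1 hDA h hj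
    · exact Finset.disjoint_left.1 hDB h hj
    · exact Finset.disjoint_left.1 hDC h hj
  rw [heq] at hInt
  -- Integrating out the variables in D, which both factors share, is the definition of the
  -- contraction.
  have hce := hX.condExp_eq_integral (L := A ∪ B ∪ C) (e := e) (d := enum D l)
    (enumTriple_mem hA hB hC) (enum_injective hD) hDM
    (measurable_contractionIntegrand hψm hφm r l) hInt
  rw [← heq] at hce
  have hce' : P[pairProd X ψ φ (A ∪ B ∪ D) (A ∪ C ∪ D) | sigmaOf X (A ∪ B ∪ C)] =ᵐ[P]
      fun ω => contraction μ ψ φ r l fun i => X (e i) ω := hce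
  -- The contraction along X is integrable because it is a version of a conditional expectation.
  have hk := hX.kernelComponent_ae_eq (enumTriple_injective hA hB hC hAB hAC hBC)
    (measurable_contraction μ hψm hφm r l) (integrable_condExp.congr hce')
    (image_enumTriple hA hB hC hAB hAC hBC)
  simp only [pickTriple_eq]
  exact (hX.hoeffdingComponent_condExp _ _).symm.trans
    ((hoeffdingComponent_congr hce' _).trans hk)

end IsIID
end UStat

/-! ### Combinatorics of pairs (J, K) and triples (A, B, C). -/

namespace UStat

theorem mem_triples {p q r n m : ℕ} {A B C L : Finset ℕ} :
    (A, B, C) ∈ triples p q r n m L ↔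
      (A ⊆ Finset.range n ∧ A.card = 2 * r + L.card - (p + q)) ∧
      (B ⊆ Finset.range n ∧ B.card = p - r) ∧ (C ⊆ Finset.range m ∧ C.card = q - r) ∧
      Disjoint A B ∧ Disjoint A C ∧ Disjoint B C ∧ A ∪ B ∪ C = L := by
  simp only [triples, Finset.mem_filter, Finset.mem_product, Finset.mem_powersetCard]
  tauto

theorem mem_rRange {p q k s r : ℕ} : r ∈ rRange p q k s ↔
    (p + q - k + 1) / 2 ≤ r ∧ r ≤ p ∧ r ≤ q - s ∧ r ≤ p + q - k := by
  simp only [rRange, Finset.mem_Icc, le_min_iff]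

/-- The pairs `(J, K)` of index sets with `J △ K ⊆ M ⊆ J ∪ K`. -/
def pairsAt (p q n m : ℕ) (M : Finset ℕ) : Finset (Finset ℕ × Finset ℕ) :=
  (Finset.powersetCard p (Finset.range n) ×ˢ Finset.powersetCard q (Finset.range m)).filter
    fun x => x.1 \ x.2 ⊆ M ∧ x.2 \ x.1 ⊆ M ∧ M ⊆ x.1 ∪ x.2

theorem mem_pairsAt {p q n m : ℕ} {M J K : Finset ℕ} : (J, K) ∈ pairsAt p q n m M ↔
    (J ⊆ Finset.range n ∧ J.card = p) ∧ (K ⊆ Finset.range m ∧ K.card = q) ∧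
      J \ K ⊆ M ∧ K \ J ⊆ M ∧ M ⊆ J ∪ K := by
  simp only [pairsAt, Finset.mem_filter, Finset.mem_product, Finset.mem_powersetCard]
  tauto

/-- The cardinalities of the parts into which `J` and `K` cut `M`. -/
theorem card_of_mem_pairsAt {p q n m : ℕ} {M J K : Finset ℕ} (h : (J, K) ∈ pairsAt p q n m M) :
    (J \ K).card + (J ∩ K).card = p ∧ (K \ J).card + (J ∩ K).card = q ∧
    (M ∩ (J ∩ K)).card + ((J ∩ K) \ M).card = (J ∩ K).card ∧
    (M ∩ (J ∩ K)).card + (J \ K).card + (K \ J).card = M.card ∧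
    (M ∩ Finset.Ico n m).card ≤ (K \ J).card ∧
    (M ∩ (J ∩ K)) ∪ (J \ K) ∪ (K \ J) = M := by
  obtain ⟨⟨hJn, hJ⟩, ⟨hKm, hK⟩, h1, h2, h3⟩ := mem_pairsAt.1 h
  have hM : (M ∩ (J ∩ K)) ∪ (J \ K) ∪ (K \ J) = M := by
    ext i
    have h1' := @h1 i
    have h2' := @h2 i
    have h3' := @h3 i
    simp only [Finset.mem_union, Finset.mem_inter, Finset.mem_sdiff] at *
    tauto
  refine ⟨?_, ?_, ?_, ?_, ?_, hM⟩
  · rw [Finset.card_sdiff_add_card_inter, hJ]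
  · rw [Finset.inter_comm, Finset.card_sdiff_add_card_inter, hK]
  · rw [Finset.inter_comm, Finset.card_inter_add_card_sdiff]
  · rw [← Finset.card_union_of_disjoint, ← Finset.card_union_of_disjoint, hM]
    · refine Finset.disjoint_left.2 fun i => ?_
      simp only [Finset.mem_union, Finset.mem_inter, Finset.mem_sdiff]
      tauto
    · refine Finset.disjoint_left.2 fun i => ?_
      simp only [Finset.mem_inter, Finset.mem_sdiff]
      tauto
  -- An index of M beyond [n] cannot lie in J ⊆ [n], hence lies in K \ J. This is the source of the
  -- bound r ≤ q - s.
  · refine Finset.card_le_card fun i hi => ?_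
    have h3' := @h3 i
    have hJn' := @hJn i
    simp only [Finset.mem_union, Finset.mem_inter, Finset.mem_sdiff, Finset.mem_Ico,
      Finset.mem_range] at *
    have : i ∉ J := fun h => by have := hJn' h; omega
    tauto

/-- Recovers A, B, C and D from J = A ∪ B ∪ D and K = A ∪ C ∪ D, which gives one of the two inverse
identities in `sum_pairsAt`. -/
theorem parts_of_disjoint {A B C D M : Finset ℕ} (hAB : Disjoint A B) (hAC : Disjoint A C)
    (hBC : Disjoint B C) (hM : A ∪ B ∪ C = M) (hDM : Disjoint D M) :
    Disjoint A D ∧ (A ∪ B ∪ D) ∩ (A ∪ C ∪ D) = A ∪ D ∧ M ∩ (A ∪ D) = A ∧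
      (A ∪ B ∪ D) \ (A ∪ C ∪ D) = B ∧ (A ∪ C ∪ D) \ (A ∪ B ∪ D) = C ∧ (A ∪ D) \ M = D := by
  subst hM
  rw [Finset.disjoint_left] at *
  refine ⟨?_, ?_, ?_, ?_, ?_, ?_⟩ <;> grind

/-- The pairs `(J, K)` with `J △ K ⊆ M ⊆ J ∪ K` correspond to the order `r = |J ∩ K|`, the triple
`(M ∩ J ∩ K, J \ K, K \ J)` and the set `(J ∩ K) \ M`. -/
theorem sum_pairsAt {β : Type*} [AddCommMonoid β] {p q n m k s : ℕ} {M : Finset ℕ}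
    (hnm : n ≤ m) (hk : M.card = k) (hs : (M ∩ Finset.Ico n m).card = s) (hkpq : k ≤ p + q)
    (F : Finset ℕ → Finset ℕ → β) :
    ∑ x ∈ pairsAt p q n m M, F x.1 x.2 =
      ∑ r ∈ rRange p q k s, ∑ S ∈ triples p q r n m M,
        ∑ D ∈ Finset.powersetCard (p + q - r - k) (Finset.range n \ M),
          F (S.1 ∪ S.2.1 ∪ D) (S.1 ∪ S.2.2 ∪ D) := by
  simp only [← Finset.sum_product']
  rw [Finset.sum_sigma']
  symm
  refine Finset.sum_bij'
    (fun y _ => (y.2.1.1 ∪ y.2.1.2.1 ∪ y.2.2, y.2.1.1 ∪ y.2.1.2.2 ∪ y.2.2))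
    (fun x _ => ⟨(x.1 ∩ x.2).card, ((M ∩ (x.1 ∩ x.2), x.1 \ x.2, x.2 \ x.1), (x.1 ∩ x.2) \ M)⟩)
    ?_ ?_ ?_ ?_ ?_
  · rintro ⟨r, ⟨A, B, C⟩, D⟩ hy
    simp only [Finset.mem_sigma, Finset.mem_product, mem_rRange, mem_triples,
      Finset.mem_powersetCard] at hy
    obtain ⟨hr, ⟨⟨hAn, hA⟩, ⟨hBn, hB⟩, ⟨hCm, hC⟩, hAB, hAC, hBC, hM⟩, hDn, hD⟩ := hy
    have hDM : ∀ i ∈ D, i ∉ M := fun i hi => (Finset.mem_sdiff.1 (hDn hi)).2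
    have hM' : ∀ i, i ∈ M ↔ (i ∈ A ∨ i ∈ B) ∨ i ∈ C := fun i => by
      rw [← hM, Finset.mem_union, Finset.mem_union]
    have hAD : Disjoint A D :=
      Finset.disjoint_right.2 fun i hi h => hDM i hi ((hM' i).2 (.inl (.inl h)))
    have hBD : Disjoint B D :=
      Finset.disjoint_right.2 fun i hi h => hDM i hi ((hM' i).2 (.inl (.inr h)))
    have hCD : Disjoint C D :=
      Finset.disjoint_right.2 fun i hi h => hDM i hi ((hM' i).2 (.inr h))
    refine mem_pairsAt.2 ⟨⟨?_, ?_⟩, ⟨?_, ?_⟩, ?_, ?_, ?_⟩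
    · exact Finset.union_subset (Finset.union_subset hAn hBn) (hDn.trans Finset.sdiff_subset)
    · rw [Finset.card_union_of_disjoint (Finset.disjoint_union_left.2 ⟨hAD, hBD⟩),
        Finset.card_union_of_disjoint hAB]
      omega
    · exact Finset.union_subset (Finset.union_subset (hAn.trans (Finset.range_mono hnm)) hCm)
        ((hDn.trans Finset.sdiff_subset).trans (Finset.range_mono hnm))
    · rw [Finset.card_union_of_disjoint (Finset.disjoint_union_left.2 ⟨hAD, hCD⟩),
        Finset.card_union_of_disjoint hAC]
      omega
    all_goals
      intro i
      have := hM' i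
      simp only [Finset.mem_union, Finset.mem_sdiff]
      tauto
  · rintro ⟨J, K⟩ hx
    have hc := card_of_mem_pairsAt hx
    obtain ⟨⟨hJn, hJ⟩, ⟨hKm, hK⟩, h1, h2, h3⟩ := mem_pairsAt.1 hx
    simp only [Finset.mem_sigma, Finset.mem_product, mem_rRange, mem_triples,
      Finset.mem_powersetCard]
    have hd : Disjoint (M ∩ (J ∩ K)) (J \ K) ∧ Disjoint (M ∩ (J ∩ K)) (K \ J) ∧
        Disjoint (J \ K) (K \ J) := by
      refine ⟨?_, ?_, ?_⟩ <;> refine Finset.disjoint_left.2 fun i => ?_ <;>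
        simp only [Finset.mem_inter, Finset.mem_sdiff] <;> tauto
    -- The range of r: the lower bound says |A| = 2r + k - p - q ≥ 0, the upper ones |B| ≥ 0, |C| ≥
    -- s and |D| = p + q - r - k ≥ 0.
    refine ⟨by omega, ⟨⟨fun i hi => hJn ?_, by omega⟩, ⟨fun i hi => hJn ?_, by omega⟩,
      ⟨fun i hi => hKm ?_, by omega⟩, hd.1, hd.2.1, hd.2.2, hc.2.2.2.2.2⟩,
      Finset.sdiff_subset_sdiff (Finset.inter_subset_left.trans hJn) subset_rfl, by omega⟩
    · exact (Finset.mem_inter.1 (Finset.mem_inter.1 hi).2).1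
    · exact (Finset.mem_sdiff.1 hi).1
    · exact (Finset.mem_sdiff.1 hi).1
  · rintro ⟨r, ⟨A, B, C⟩, D⟩ hy
    simp only [Finset.mem_sigma, Finset.mem_product, mem_rRange, mem_triples,
      Finset.mem_powersetCard] at hy
    obtain ⟨hr, ⟨⟨hAn, hA⟩, ⟨hBn, hB⟩, ⟨hCm, hC⟩, hAB, hAC, hBC, hM⟩, hDn, hD⟩ := hy
    have hDM : Disjoint D M := Finset.disjoint_left.2 fun i h => (Finset.mem_sdiff.1 (hDn h)).2
    obtain ⟨hAD, hJK, e1, e2, e3, e4⟩ := parts_of_disjoint hAB hAC hBC hM hDM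
    have e0 : (A ∪ D).card = r := by
      rw [Finset.card_union_of_disjoint hAD]
      omega
    simp only [hJK, e0, e1, e2, e3, e4]
  · rintro ⟨J, K⟩ hx
    refine Prod.ext (Finset.ext fun i => ?_) (Finset.ext fun i => ?_) <;>
      simp only [Finset.mem_union, Finset.mem_inter, Finset.mem_sdiff] <;> tauto
  · intros
    rfl

theorem card_inter_range {n m k s : ℕ} {M : Finset ℕ} (hMm : M ⊆ Finset.range m)
    (hk : M.card = k) (hs : (M ∩ Finset.Ico n m).card = s) :
    (M ∩ Finset.range n).card = k - s := by
  have hsplit : M \ (M ∩ Finset.Ico n m) = M ∩ Finset.range n := by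
    ext i
    have := @hMm i
    simp only [Finset.mem_inter, Finset.mem_sdiff, Finset.mem_Ico, Finset.mem_range] at *
    constructor
    · rintro ⟨h, h'⟩
      exact ⟨h, by by_contra hn; exact h' ⟨h, by omega, this h⟩⟩
    · rintro ⟨h, h'⟩
      exact ⟨h, by omega⟩
  rw [← hsplit, Finset.card_sdiff_of_subset Finset.inter_subset_left, hk, hs]

/-- A triple is determined by A and B, since C = M \ (A ∪ B). Both are disjoint subsets of M ∩ [n],
which has k - s elements, so choosing A and then B gives the multinomial coefficient. -/
theorem card_triples_le {p q r n m k s : ℕ} {M : Finset ℕ} (hMm : M ⊆ Finset.range m)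
    (hk : M.card = k) (hs : (M ∩ Finset.Ico n m).card = s) (hr : r ∈ rRange p q k s)
    (hsq : s ≤ q) (hkpq : k ≤ p + q) :
    (triples p q r n m M).card ≤
      trinomial (k - s) (2 * r + k - (p + q)) (p - r) (q - r - s) := by
  rw [mem_rRange] at hr
  have hN := card_inter_range hMm hk hs
  have hsk : s ≤ k := hs ▸ hk ▸ Finset.card_le_card Finset.inter_subset_left
  set a := 2 * r + k - (p + q) with ha
  have hle : (triples p q r n m M).card ≤ ((Finset.powersetCard a (M ∩ Finset.range n)).sigma
      fun A => Finset.powersetCard (p - r) ((M ∩ Finset.range n) \ A)).card := by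
    refine Finset.card_le_card_of_injOn (fun S => ⟨S.1, S.2.1⟩) ?_ ?_
    · rintro ⟨A, B, C⟩ hS
      obtain ⟨⟨hAn, hA⟩, ⟨hBn, hB⟩, -, hAB, -, -, hM⟩ := mem_triples.1 hS
      have hAM : A ⊆ M := hM ▸ Finset.subset_union_left.trans Finset.subset_union_left
      have hBM : B ⊆ M := hM ▸ Finset.subset_union_right.trans Finset.subset_union_left
      simp only [Finset.coe_sigma, Set.mem_sigma_iff, Finset.mem_coe, Finset.mem_powersetCard]
      exact ⟨⟨Finset.subset_inter hAM hAn, by rw [hA, hk]⟩,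
        Finset.subset_sdiff.2 ⟨Finset.subset_inter hBM hBn, hAB.symm⟩, hB⟩
    · rintro ⟨A, B, C⟩ hS ⟨A', B', C'⟩ hS' h
      obtain ⟨-, -, -, -, hAC, hBC, hM⟩ := mem_triples.1 hS
      obtain ⟨-, -, -, -, hAC', hBC', hM'⟩ := mem_triples.1 hS'
      simp only [Sigma.mk.injEq, heq_eq_eq] at h
      obtain ⟨rfl, rfl⟩ := h
      have hC : M \ (A ∪ B) = C := by
        rw [← hM]
        exact Finset.union_sdiff_cancel_left (Finset.disjoint_union_left.2 ⟨hAC, hBC⟩)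
      have hC' : M \ (A ∪ B) = C' := by
        rw [← hM']
        exact Finset.union_sdiff_cancel_left (Finset.disjoint_union_left.2 ⟨hAC', hBC'⟩)
      rw [← hC, ← hC']
  refine hle.trans (le_of_eq ?_)
  rw [Finset.card_sigma, Finset.sum_congr rfl (g := fun _ => (k - s - a).choose (p - r))]
  · rw [Finset.sum_const, Finset.card_powersetCard, hN, smul_eq_mul, trinomial]
    have h1 := Nat.choose_mul_factorial_mul_factorial (n := k - s) (k := a) (by omega)
    have h2 := Nat.choose_mul_factorial_mul_factorial (n := k - s - a) (k := p - r) (by omega)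
    rw [show k - s - a - (p - r) = q - r - s by omega] at h2
    refine (Nat.div_eq_of_eq_mul_left (by positivity) ?_).symm
    rw [← h1, ← h2]
    ring
  · intro A hA
    obtain ⟨hAN, hA⟩ := Finset.mem_powersetCard.1 hA
    rw [Finset.card_powersetCard, Finset.card_sdiff_of_subset hAN, hN, hA]

end UStat

/-! ### Components of the product of U-statistics and the variance bound. -/

namespace UStat

theorem eLpNorm_fun_sum_le {Ω ι : Type*} [MeasurableSpace Ω] {P : Measure Ω} {s : Finset ι}
    {f : ι → Ω → ℝ} {c : ℝ≥0∞} (hf : ∀ i ∈ s, AEStronglyMeasurable (f i) P) (hc : 1 ≤ c) :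
    eLpNorm (fun ω => ∑ i ∈ s, f i ω) c P ≤ ∑ i ∈ s, eLpNorm (f i) c P := by
  have h : (fun ω => ∑ i ∈ s, f i ω) = ∑ i ∈ s, f i := by
    ext ω
    rw [Finset.sum_apply]
  rw [h]
  exact eLpNorm_sum_le hf hc

theorem measurable_uStat_mul_uStat {Ω E : Type*} [MeasurableSpace E] {X : ℕ → Ω → E} {p q : ℕ}
    {ψ : (Fin p → E) → ℝ} {φ : (Fin q → E) → ℝ}
    (hψ : Measurable ψ) (hφ : Measurable φ) {n m : ℕ}
    (hnm : n ≤ m) :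
    Measurable[sigmaOf X (Finset.range m)] fun ω => uStat X n ψ ω * uStat X m φ ω := by
  simp only [uStat_mul_uStat]
  refine Finset.measurable_fun_sum _ fun x hx => ?_
  simp only [Finset.mem_product, Finset.mem_powersetCard] at hx
  exact measurable_pairProd hψ hφ hx.1.2 hx.2.2 (hx.1.1.trans (Finset.range_mono hnm)) hx.2.1

namespace IsIID

variable {Ω E : Type*} [MeasurableSpace Ω] [mE : MeasurableSpace E] {P : Measure Ω}
  {μ : Measure E} {X : ℕ → Ω → E} [IsProbabilityMeasure P]
  {p q : ℕ} {ψ : (Fin p → E) → ℝ} {φ : (Fin q → E) → ℝ}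

theorem integrable_uStat_mul_uStat (hX : IsIID P μ X) (hψ2 : MemLp ψ 2 (powMeasure μ (Fin p)))
    (hφ2 : MemLp φ 2 (powMeasure μ (Fin q))) (n m : ℕ) :
    Integrable (fun ω => uStat X n ψ ω * uStat X m φ ω) P := by
  simp only [uStat_mul_uStat]
  refine integrable_finsetSum _ fun x hx => ?_
  simp only [Finset.mem_product, Finset.mem_powersetCard] at hx
  exact hX.integrable_pairProd hψ2 hφ2 hx.1.2 hx.2.2

theorem hoeffdingComponent_uStat_mul_uStat (hX : IsIID P μ X)
    (hp : 1 ≤ p) (hq : 1 ≤ q) (hψm : Measurable ψ)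
    (hψ2 : MemLp ψ 2 (powMeasure μ (Fin p))) (hψs : IsSymm ψ) (hψd : IsDegenerate μ ψ)
    (hφm : Measurable φ) (hφ2 : MemLp φ 2 (powMeasure μ (Fin q))) (hφs : IsSymm φ)
    (hφd : IsDegenerate μ φ)
    (n m : ℕ) (M : Finset ℕ) :
    hoeffdingComponent P X (fun ω => uStat X n ψ ω * uStat X m φ ω) M =ᵐ[P]
      fun ω => ∑ x ∈ pairsAt p q n m M,
        hoeffdingComponent P X (pairProd X ψ φ x.1 x.2) M ω := by
  simp only [uStat_mul_uStat]
  have hcard : ∀ x ∈ Finset.powersetCard p (Finset.range n) ×ˢ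
      Finset.powersetCard q (Finset.range m), x.1.card = p ∧ x.2.card = q := fun x hx => by
    simp only [Finset.mem_product, Finset.mem_powersetCard] at hx
    exact ⟨hx.1.2, hx.2.2⟩
  have h1 := hoeffdingComponent_sum (P := P) (X := X) (Finset.powersetCard p (Finset.range n) ×ˢ
    Finset.powersetCard q (Finset.range m)) (V := fun x => pairProd X ψ φ x.1 x.2)
    (fun x hx => hX.integrable_pairProd hψ2 hφ2 (hcard x hx).1 (hcard x hx).2) M
  have h2 : ∀ᵐ ω ∂P, ∀ x ∈ Finset.powersetCard p (Finset.range n) ×ˢ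
      Finset.powersetCard q (Finset.range m), ¬ (x.1 \ x.2 ⊆ M ∧ x.2 \ x.1 ⊆ M ∧ M ⊆ x.1 ∪ x.2) →
        hoeffdingComponent P X (pairProd X ψ φ x.1 x.2) M ω = 0 := by
    refine (ae_ball_iff (Finset.countable_toSet _)).2 fun x hx => ?_
    by_cases h : x.1 \ x.2 ⊆ M ∧ x.2 \ x.1 ⊆ M ∧ M ⊆ x.1 ∪ x.2
    · exact .of_forall fun ω h' => absurd h h'
    · filter_upwards [hX.hoeffdingComponent_pairProd_eq_zero hp hq hψm hψ2 hψs hψd hφm hφ2 hφs hφd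
        (hcard x hx).1 (hcard x hx).2 h] with ω hω _ using hω
  filter_upwards [h1, h2] with ω hω hω'
  rw [hω, pairsAt, Finset.sum_filter_of_ne]
  intro x hx hne
  by_contra h
  exact hne (hω' x hx h)

/-- No pair contributes: a contributing one would give |p - q| ≤ |J △ K| ≤ |M| ≤ |J ∪ K| ≤ p + q and
|M ∩ {n+1, …, m}| ≤ |K \ J| ≤ q. -/
theorem hoeffdingComponent_uStat_mul_uStat_eq_zero (hX : IsIID P μ X)
    (hp : 1 ≤ p) (hq : 1 ≤ q) (hψm : Measurable ψ)
    (hψ2 : MemLp ψ 2 (powMeasure μ (Fin p))) (hψs : IsSymm ψ) (hψd : IsDegenerate μ ψ)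
    (hφm : Measurable φ) (hφ2 : MemLp φ 2 (powMeasure μ (Fin q))) (hφs : IsSymm φ)
    (hφd : IsDegenerate μ φ)
    {n m : ℕ} {M : Finset ℕ}
    (hM : ¬ (((p : ℤ) - (q : ℤ)).natAbs ≤ M.card ∧ M.card ≤ p + q ∧
      (M ∩ Finset.Ico n m).card ≤ q)) :
    hoeffdingComponent P X (fun ω => uStat X n ψ ω * uStat X m φ ω) M =ᵐ[P] 0 := by
  have hempty : pairsAt p q n m M = ∅ := by
    refine Finset.eq_empty_of_forall_notMem ?_
    rintro ⟨J, K⟩ h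
    have := card_of_mem_pairsAt h
    omega
  filter_upwards [hX.hoeffdingComponent_uStat_mul_uStat hp hq hψm hψ2 hψs hψd hφm hφ2 hφs hφd
    n m M] with ω hω
  rw [hω, hempty, Finset.sum_empty, Pi.zero_apply]

/-- After the reindexing by (r, (A, B, C), D) the summand no longer depends on D, so the sum over D
only counts subsets of [n] \ M. -/
theorem hoeffdingComponent_uStat_mul_uStat_eq (hX : IsIID P μ X)
    (hp : 1 ≤ p) (hq : 1 ≤ q) (hψm : Measurable ψ)
    (hψ2 : MemLp ψ 2 (powMeasure μ (Fin p))) (hψs : IsSymm ψ) (hψd : IsDegenerate μ ψ)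
    (hφm : Measurable φ) (hφ2 : MemLp φ 2 (powMeasure μ (Fin q))) (hφs : IsSymm φ)
    (hφd : IsDegenerate μ φ)
    {n m : ℕ} (hnm : n ≤ m) (hn : p + q ≤ n)
    {M : Finset ℕ} (hMm : M ⊆ Finset.range m) {k s : ℕ} (hk : M.card = k)
    (hs : (M ∩ Finset.Ico n m).card = s) (hkpq : k ≤ p + q) :
    hoeffdingComponent P X (fun ω => uStat X n ψ ω * uStat X m φ ω) M =ᵐ[P] fun ω =>
      ∑ r ∈ rRange p q k s, ((n - k + s).choose (p + q - r - k) : ℝ) *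
        ∑ S ∈ triples p q r n m M,
          kernelComponent μ (contraction μ ψ φ r (p + q - r - k)) Finset.univ
            (pickTriple (fun i => X i ω) p q r (p + q - r - k) S) := by
  have hsk : s ≤ k := hs ▸ hk ▸ Finset.card_le_card Finset.inter_subset_left
  -- Since k ≤ p + q ≤ n, the natural-number subtraction n - k is exact.
  have hcard : (Finset.range n \ M).card = n - k + s := by
    rw [Finset.card_sdiff, card_inter_range hMm hk hs, Finset.card_range]
    omega
  have h1 : ∀ᵐ ω ∂P, ∀ r ∈ rRange p q k s, ∀ S ∈ triples p q r n m M,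
      ∀ D ∈ Finset.powersetCard (p + q - r - k) (Finset.range n \ M),
      hoeffdingComponent P X (pairProd X ψ φ (S.1 ∪ S.2.1 ∪ D) (S.1 ∪ S.2.2 ∪ D)) M ω
        = kernelComponent μ (contraction μ ψ φ r (p + q - r - k)) Finset.univ
            (pickTriple (fun i => X i ω) p q r (p + q - r - k) S) := by
    refine (ae_ball_iff (Finset.countable_toSet _)).2 fun r hr => ?_
    refine (ae_ball_iff (Finset.countable_toSet _)).2 fun S hS => ?_
    refine (ae_ball_iff (Finset.countable_toSet _)).2 fun D hD => ?_
    obtain ⟨A, B, C⟩ := S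
    obtain ⟨⟨-, hA⟩, ⟨-, hB⟩, ⟨-, hC⟩, hAB, hAC, hBC, hM⟩ := mem_triples.1 hS
    obtain ⟨hDn, hD⟩ := Finset.mem_powersetCard.1 hD
    have hr' := mem_rRange.1 hr
    have hDM : Disjoint D (A ∪ B ∪ C) := hM ▸ (Finset.subset_sdiff.1 hDn).2
    simp only [Finset.disjoint_union_right] at hDM
    have h := hX.hoeffdingComponent_pairProd hψm hψ2 hψs hφm hφ2 hφs (r := r)
      (l := p + q - r - k) (by omega) (by omega) (by omega) (by omega) hB hC hD hAB hAC hBC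
      hDM.1.1 hDM.1.2 hDM.2
    rw [hM] at h
    exact h
  filter_upwards [hX.hoeffdingComponent_uStat_mul_uStat hp hq hψm hψ2 hψs hψd hφm hφ2 hφs hφd
    n m M, h1] with ω hω hω'
  rw [hω, sum_pairsAt hnm hk hs hkpq
    fun J K => hoeffdingComponent P X (pairProd X ψ φ J K) M ω]
  refine Finset.sum_congr rfl fun r hr => ?_
  rw [Finset.mul_sum]
  refine Finset.sum_congr rfl fun S hS => ?_
  rw [Finset.sum_congr rfl (hω' r hr S hS), Finset.sum_const, Finset.card_powersetCard, hcard,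
    nsmul_eq_mul]

/-- The triangle inequality over r and over the triples, each triple costing at most the norm of the
contraction. Working in `ℝ≥0∞` covers infinite norms. -/
theorem evariance_hoeffdingComponent_uStat_mul_uStat_le (hX : IsIID P μ X)
    (hp : 1 ≤ p) (hq : 1 ≤ q) (hψm : Measurable ψ)
    (hψ2 : MemLp ψ 2 (powMeasure μ (Fin p))) (hψs : IsSymm ψ) (hψd : IsDegenerate μ ψ)
    (hφm : Measurable φ) (hφ2 : MemLp φ 2 (powMeasure μ (Fin q))) (hφs : IsSymm φ)
    (hφd : IsDegenerate μ φ)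
    {n m : ℕ} (hnm : n ≤ m)
    (hn : p + q ≤ n) {M : Finset ℕ} (hMm : M ⊆ Finset.range m) {k s : ℕ} (hk : M.card = k)
    (hs : (M ∩ Finset.Ico n m).card = s) (hkpq : k ≤ p + q) (hsq : s ≤ q) :
    evariance (hoeffdingComponent P X (fun ω => uStat X n ψ ω * uStat X m φ ω) M) P
        ^ (1 / 2 : ℝ) ≤
      ∑ r ∈ rRange p q k s, ((n - k + s).choose (p + q - r - k) : ℝ≥0∞) *
        (trinomial (k - s) (2 * r + k - (p + q)) (p - r) (q - r - s) : ℝ≥0∞) *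
          eLpNorm (contraction μ ψ φ r (p + q - r - k)) 2
            (powMeasure μ (Args p q r (p + q - r - k))) := by
  have : IsProbabilityMeasure μ := by
    rw [← hX.law 0]; exact Measure.isProbabilityMeasure_map (hX.measurable 0).aemeasurable
  have hm : ∀ r S, Measurable fun ω =>
      kernelComponent μ (contraction μ ψ φ r (p + q - r - k)) Finset.univ
        (pickTriple (fun i => X i ω) p q r (p + q - r - k) S) := fun r S => by
    simp only [pickTriple_eq]
    exact (measurable_kernelComponent μ (measurable_contraction μ hψm hφm r _) _).comp
      (hX.measurable_pi _)
  refine (evariance_rpow_le_eLpNorm (integrable_hoeffdingComponent _ M).1).trans ?_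
  rw [eLpNorm_congr_ae (hX.hoeffdingComponent_uStat_mul_uStat_eq hp hq hψm hψ2 hψs hψd hφm hφ2
    hφs hφd hnm hn hMm hk hs hkpq)]
  refine (eLpNorm_fun_sum_le (fun r _ => ((Finset.measurable_fun_sum _ fun S _ =>
    hm r S).const_mul _).aestronglyMeasurable) one_le_two).trans (Finset.sum_le_sum fun r hr => ?_)
  have hr' := mem_rRange.1 hr
  have hS : ∀ S ∈ triples p q r n m M, eLpNorm (fun ω =>
      kernelComponent μ (contraction μ ψ φ r (p + q - r - k)) Finset.univ
        (pickTriple (fun i => X i ω) p q r (p + q - r - k) S)) 2 P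
      ≤ eLpNorm (contraction μ ψ φ r (p + q - r - k)) 2
        (powMeasure μ (Args p q r (p + q - r - k))) := by
    rintro ⟨A, B, C⟩ hS
    obtain ⟨⟨-, hA⟩, ⟨-, hB⟩, ⟨-, hC⟩, hAB, hAC, hBC, -⟩ := mem_triples.1 hS
    simp only [pickTriple_eq]
    exact hX.eLpNorm_kernelComponent_le
      (enumTriple_injective (by omega) hB hC hAB hAC hBC) (measurable_contraction μ hψm hφm r _)
  refine (eLpNorm_const_smul_le (c := ((n - k + s).choose (p + q - r - k) : ℝ))).trans ?_
  rw [mul_assoc]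
  refine mul_le_mul' (by simp) ?_
  calc _ ≤ ∑ S ∈ triples p q r n m M, eLpNorm (fun ω =>
        kernelComponent μ (contraction μ ψ φ r (p + q - r - k)) Finset.univ
          (pickTriple (fun i => X i ω) p q r (p + q - r - k) S)) 2 P :=
        eLpNorm_fun_sum_le (fun S _ => (hm r S).aestronglyMeasurable) one_le_two
    _ ≤ (triples p q r n m M).card • eLpNorm (contraction μ ψ φ r (p + q - r - k)) 2
          (powMeasure μ (Args p q r (p + q - r - k))) := Finset.sum_le_card_nsmul _ _ _ hS
    _ ≤ _ := by
        rw [nsmul_eq_mul]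
        gcongr
        exact card_triples_le hMm hk hs hr hsq hkpq

end IsIID
end UStat

theorem proposition5p1 {Ω E : Type*} [MeasurableSpace Ω] [MeasurableSpace E]
    (P : Measure Ω) [IsProbabilityMeasure P] (μ : Measure E) [IsProbabilityMeasure μ]
    (X : ℕ → Ω → E) (hX : ∀ i, Measurable (X i)) (hindep : iIndepFun X P)
    (hlaw : ∀ i, P.map (X i) = μ)
    (p q : ℕ) (hp : 1 ≤ p) (hq : 1 ≤ q)
    (ψ : (Fin p → E) → ℝ) (hψm : Measurable ψ) (hψ2 : MemLp ψ 2 (powMeasure μ (Fin p)))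
    (hψs : IsSymm ψ) (hψd : IsDegenerate μ ψ)
    (φ : (Fin q → E) → ℝ) (hφm : Measurable φ) (hφ2 : MemLp φ 2 (powMeasure μ (Fin q)))
    (hφs : IsSymm φ) (hφd : IsDegenerate μ φ)
    (n m : ℕ) (hnm : n ≤ m) (hn : p + q ≤ n)
    (T : Ω → ℝ) (hT : T = fun ω => uStat X n ψ ω * uStat X m φ ω)
    (U : Finset ℕ → Ω → ℝ) (hU : U = hoeffdingComponent P X T) :
    Integrable T P ∧
    IsHoeffdingDecomposition P X m T U ∧
    (T =ᵐ[P] fun ω => ∑ M ∈ (Finset.range m).powerset with M.card ≤ p + q, U M ω) ∧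
    (T =ᵐ[P] fun ω =>
      ∑ k ∈ Finset.Icc ((p : ℤ) - (q : ℤ)).natAbs (p + q),
        ∑ s ∈ Finset.Icc 0 (min q (min k (m - n))),
          ∑ M ∈ (Finset.range m).powerset with M.card = k ∧ (M ∩ Finset.Ico n m).card = s,
            U M ω) ∧
    ∀ M ⊆ Finset.range m, ∀ k s : ℕ, M.card = k → (M ∩ Finset.Ico n m).card = s →
      k ≤ p + q → s ≤ min q (min k (m - n)) →
      (U M =ᵐ[P] fun ω =>
        ∑ r ∈ rRange p q k s, ((n - k + s).choose (p + q - r - k) : ℝ) *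
          ∑ S ∈ triples p q r n m M,
            kernelComponent μ (contraction μ ψ φ r (p + q - r - k)) Finset.univ
              (pickTriple (fun i => X i ω) p q r (p + q - r - k) S)) ∧
      evariance (U M) P ^ (1 / 2 : ℝ) ≤
        ∑ r ∈ rRange p q k s, ((n - k + s).choose (p + q - r - k) : ℝ≥0∞) *
          (trinomial (k - s) (2 * r + k - (p + q)) (p - r) (q - r - s) : ℝ≥0∞) *
            eLpNorm (contraction μ ψ φ r (p + q - r - k)) 2
              (powMeasure μ (Args p q r (p + q - r - k))) := by
  have hiid : IsIID P μ X := ⟨hX, hindep, hlaw⟩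
  subst hT hU
  have hInt := hiid.integrable_uStat_mul_uStat hψ2 hφ2 n m
  have hdec := hiid.isHoeffdingDecomposition
    (measurable_uStat_mul_uStat (X := X) hψm hφm hnm) hInt
  -- Both restricted sums arise from the full decomposition by deleting components that vanish off
  -- this null set.
  have hzero : ∀ᵐ ω ∂P, ∀ M : Finset ℕ, ¬ (((p : ℤ) - (q : ℤ)).natAbs ≤ M.card ∧
      M.card ≤ p + q ∧ (M ∩ Finset.Ico n m).card ≤ q) →
        hoeffdingComponent P X (fun ω => uStat X n ψ ω * uStat X m φ ω) M ω = 0 :=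
    ae_all_iff.2 fun M => by
      by_cases h : ((p : ℤ) - (q : ℤ)).natAbs ≤ M.card ∧ M.card ≤ p + q ∧
        (M ∩ Finset.Ico n m).card ≤ q
      · exact .of_forall fun ω h' => absurd h h'
      · filter_upwards [hiid.hoeffdingComponent_uStat_mul_uStat_eq_zero hp hq hψm hψ2 hψs hψd hφm
          hφ2 hφs hφd h] with ω hω _ using hω
  refine ⟨hInt, hdec, ?_, ?_, ?_⟩
  · filter_upwards [hdec.sum_eq, hzero] with ω hω hω'
    rw [hω, Finset.sum_filter_of_ne]
    intro M _ hne
    by_contra h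
    exact hne (hω' M fun h' => h h'.2.1)
  · filter_upwards [hdec.sum_eq, hzero] with ω hω hω'
    rw [hω, ← Finset.sum_filter_of_ne (p := fun M : Finset ℕ =>
      ((p : ℤ) - (q : ℤ)).natAbs ≤ M.card ∧ M.card ≤ p + q ∧ (M ∩ Finset.Ico n m).card ≤ q)
      fun M _ hne => by
        by_contra h
        exact hne (hω' M h)]
    rw [← Finset.sum_fiberwise_of_maps_to (g := Finset.card)
      (t := Finset.Icc ((p : ℤ) - (q : ℤ)).natAbs (p + q))
      fun M hM => Finset.mem_Icc.2 ⟨(Finset.mem_filter.1 hM).2.1, (Finset.mem_filter.1 hM).2.2.1⟩]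
    refine Finset.sum_congr rfl fun k hk => ?_
    -- Sets of size k are sorted by s; the bounds s ≤ k and s ≤ m - n hold automatically.
    rw [← Finset.sum_fiberwise_of_maps_to (g := fun M => (M ∩ Finset.Ico n m).card)
      (t := Finset.Icc 0 (min q (min k (m - n))))]
    · refine Finset.sum_congr rfl fun s hs => Finset.sum_congr ?_ fun _ _ => rfl
      ext M
      simp only [Finset.mem_filter, Finset.mem_Icc] at hk hs ⊢
      constructor
      · rintro ⟨⟨⟨h1, -⟩, h2⟩, h3⟩
        exact ⟨h1, h2, h3⟩
      · rintro ⟨h1, h2, h3⟩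
        exact ⟨⟨⟨h1, by omega⟩, h2⟩, h3⟩
    · intro M hM
      simp only [Finset.mem_filter] at hM
      have h1 : (M ∩ Finset.Ico n m).card ≤ M.card := Finset.card_le_card Finset.inter_subset_left
      have h2 : (M ∩ Finset.Ico n m).card ≤ m - n := by
        simpa using Finset.card_le_card (Finset.inter_subset_right (s₁ := M) (s₂ := Finset.Ico n m))
      simp only [Finset.mem_Icc, le_min_iff]
      omega
  · intro M hM k s hk hs hkpq hsle
    exact ⟨hiid.hoeffdingComponent_uStat_mul_uStat_eq hp hq hψm hψ2 hψs hψd hφm hφ2 hφs hφd hnm hn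
      hM hk hs hkpq, hiid.evariance_hoeffdingComponent_uStat_mul_uStat_le hp hq hψm hψ2 hψs hψd
      hφm hφ2 hφs hφd hnm hn hM hk hs hkpq (hsle.trans (min_le_left _ _))⟩
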